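/- Let $n\ge 1$ and let $\mathbb{H}^n=\mathbb{C}^n\times\mathbb{R}$ be the Heisenberg group with group law $(z,t)(w,s)=(z+w,\,t+s+\tfrac12\operatorname{Im}(z\cdot\overline{w}))$ and Lebesgue (Haar) measure $|\cdot|$. For $k\in\mathbb{N}_0$ and $\lambda\in\mathbb{R}\setminus\{0\}$ put $$e_{k,\lambda}(z,t)=e^{i\lambda t}\,L_k^{n-1}\!\left(\tfrac12|\lambda||z|^2\right)e^{-\frac14|\lambda||z|^2},\qquad c_{n,k}=\frac{k!\,(n-1)!}{(k+n-1)!},$$ where $L_k^{n-1}$ is the Laguerre polynomial of degree $k$ and type $n-1$. Let $\Omega\subseteq\mathbb{R}^2$ be the Heisenberg fan, the union of the rays $R_k=\{(\lambda,(2k+n)|\lambda|):\lambda\ne0\}$, $k\in\mathbb{N}_0$, and $R_\infty=\{(0,\tau):\tau\ge0\}$, with the measure $$|W|=\nu_2(W)=(2\pi)^{-2n-1}\int_{\mathbb{R}}\sum_{k=0}^\infty c_{n,k}^{-2}\,\chi_W(\lambda,(2k+n)|\lambda|)\,|\lambda|^{2n}\,d\lambda .$$ For $f\in L^1\cap L^2(\mathbb{H}^n)$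 the normalized Strichartz Fourier transform is defined on $\Omega\times\mathbb{C}^n$ by $$\mathcal{F}f(a,w)=c_{n,k}\int_{\mathbb{H}^n}f(z,t)\,e_{k,\lambda}\big((z,t)^{-1}(w,0)\big)\,dz\,dt,\qquad a=(\lambda,(2k+n)|\lambda|)\in R_k,$$ and, on the $\nu_2$-null ray $R_\infty$, by $$\mathcal{F}f(0,\tau,w)=2^{n-1}(n-1)!\int_{\mathbb{H}^n} f(z,t)\,\frac{J_{n-1}(\sqrt\tau\,|w-z|)}{(\sqrt\tau\,|w-z|)^{n-1}}\,dz\,dt,$$ where $J_{n-1}$ is the Bessel function and the quotient $J_{n-1}(s)/s^{n-1}$ is continuously extended to $s=0$. The transform $\mathcal{F}$ extends to an isometry from $L^2(\mathbb{H}^n)$ into $L^2(\Omega\times\mathbb{C}^n,d\nu_2\,dw)$. For measurable $V\subseteq\mathbb{H}^n$ and $W\subseteq\Omega$ let $P_Vf=\chi_Vf$ and $P_Wf=\mathcal{F}^{-1}(\chi_{W\times\mathbb{C}^n}\mathcal{F}f)$ for $f\in L^2(\mathbb{H}^n)$. For $\epsilon_V,\epsilon_W>0$, $f$ is called $\epsilon_V$-time-limited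 on $V$ if $\|P_{V^c}f\|_2\le\epsilon_V\|f\|_2$, and $\epsilon_W$-band-limited on $W$ if $\|P_{W^c}f\|_2\le\epsilon_W\|f\|_2$, where $V^c=\mathbb{H}^n\setminus V$ and $W^c=\Omega\setminus W$. **Theorem.** Let $V\subseteq\mathbb{H}^n$ and $W\subseteq\Omega$ be measurable sets with $$W\subseteq\{(\lambda,(2k+n)|\lambda|):|\lambda|>M,\ k\in\mathbb{N}_0\}$$ for some $M>0$, and let $\epsilon_V,\epsilon_W>0$ satisfy $\epsilon_V^2+\epsilon_W^2<1$. If a nonzero $f\in L^2(\mathbb{H}^n)$ is both $\epsilon_V$-time-limited on $V$ and $\epsilon_W$-band-limited on $W$, then $$|V|\,|W|\ \ge\ (2\pi)^{-n}M^n\left(1-\sqrt{\epsilon_V^2+\epsilon_W^2}\right)^2 ,$$ where the product is taken in $[0,\infty]$ with $0\cdot\infty=0$. -/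

import Mathlib

open MeasureTheory

noncomputable section

namespace StrichartzHeisenberg

/-- The underlying space `ℂⁿ × ℝ` of the Heisenberg group `ℍⁿ`. Its `volume` is Lebesgue measure,
which is the Haar measure of the group law `mul` below. -/
abbrev Heis (n : ℕ) : Type := (Fin n → ℂ) × ℝ

/-- The group law `(z,t)(w,s) = (z + w, t + s + ½ Im (z · w̄))`. -/
def mul {n : ℕ} (p q : Heis n) : Heis n :=
  (p.1 + q.1, p.2 + q.2 + (1 / 2) * (∑ j, p.1 j * (starRingEnd ℂ) (q.1 j)).im)

/-- The group inverse `(z,t)⁻¹ = (-z,-t)`. -/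
def inv {n : ℕ} (p : Heis n) : Heis n := (-p.1, -p.2)

lemma inv_mul_self {n : ℕ} (p : Heis n) : mul (inv p) p = (0, 0) := by
  have h : ∀ z : ℂ, (-z * (starRingEnd ℂ) z).im = 0 := fun z => by
    simp [Complex.mul_im]; ring
  simp only [mul, inv, Pi.neg_apply, Complex.im_sum, h]
  simp

/-- `|z|²` for `z ∈ ℂⁿ` (the Euclidean norm squared). -/
def normSq {n : ℕ} (z : Fin n → ℂ) : ℝ := ∑ j, ‖z j‖ ^ 2

/-- The Laguerre polynomial `L_k^δ(x) = ∑_{i ≤ k} (-1)^i binom(k+δ, k-i) x^i / i!`, for a type `δ`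
that is a natural number. -/
def laguerre (δ k : ℕ) (x : ℝ) : ℝ :=
  ∑ i ∈ Finset.range (k + 1),
    (-1) ^ i * ((k + δ).choose (k - i) : ℝ) * x ^ i / (i.factorial : ℝ)

/-- The Laguerre function `φ_{k,λ}^{n-1}(z) = L_k^{n-1}(½|λ||z|²) exp(-¼|λ||z|²)`. -/
def laguerreFun (n k : ℕ) (lam : ℝ) (z : Fin n → ℂ) : ℝ :=
  laguerre (n - 1) k ((1 / 2) * |lam| * normSq z) * Real.exp (-((1 / 4) * |lam| * normSq z))

/-- The joint eigenfunction `e_{k,λ}^{n-1}(z,t) = exp(iλt) φ_{k,λ}^{n-1}(z)`. -/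
def eigenFun (n k : ℕ) (lam : ℝ) (p : Heis n) : ℂ :=
  Complex.exp (Complex.I * (lam * p.2 : ℝ)) * (laguerreFun n k lam p.1 : ℂ)

/-- The Bessel function `J_m` of the first kind, of integer order `m ≥ 0`. -/
def besselJ (m : ℕ) (x : ℝ) : ℝ :=
  ∑' j : ℕ, (-1) ^ j / ((j.factorial : ℝ) * ((j + m).factorial : ℝ)) * (x / 2) ^ (2 * j + m)

/-- `2^{n-1} (n-1)! J_{n-1}(s) / s^{n-1}`, with its limit `1` at `s = 0`. -/
def besselSpherical (n : ℕ) (s : ℝ) : ℝ :=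
  if s = 0 then 1
  else 2 ^ (n - 1) * ((n - 1).factorial : ℝ) * besselJ (n - 1) s / s ^ (n - 1)

/-- The ray `R_k = {(λ, (2k+n)|λ|) : λ ≠ 0}`. -/
def ray (n k : ℕ) : Set (ℝ × ℝ) :=
  {a | ∃ lam : ℝ, lam ≠ 0 ∧ a = (lam, (2 * k + n) * |lam|)}

/-- The limiting ray `R_∞ = {(0, τ) : τ ≥ 0}`. -/
def rayInf : Set (ℝ × ℝ) := {a | ∃ τ : ℝ, 0 ≤ τ ∧ a = (0, τ)}

/-- The Heisenberg fan `Ω`, a subset of `ℝ²`. -/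
def fan (n : ℕ) : Set (ℝ × ℝ) := (⋃ k : ℕ, ray n k) ∪ rayInf

lemma mem_fan (n k : ℕ) (lam : ℝ) : (lam, (2 * k + n) * |lam|) ∈ fan n := by
  by_cases h : lam = 0
  · exact Or.inr ⟨0, le_rfl, by simp [h]⟩
  · exact Or.inl (Set.mem_iUnion.2 ⟨k, lam, h, rfl⟩)

/-- The point `(λ, (2k+n)|λ|)` of the fan; for `λ ≠ 0` it lies on `R_k`. -/
def fanPoint (n k : ℕ) (lam : ℝ) : fan n := ⟨(lam, (2 * k + n) * |lam|), mem_fan n k lam⟩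

/-- The index `k` of the ray `R_k` through a point `(λ, τ)` of the fan with `λ ≠ 0`. -/
def fanIndex {n : ℕ} (a : fan n) : ℕ := ⌊(a.1.2 / |a.1.1| - n) / 2⌋₊

lemma fanIndex_fanPoint (n k : ℕ) {lam : ℝ} (h : lam ≠ 0) :
    fanIndex (fanPoint n k lam) = k := by
  have h' : |lam| ≠ 0 := abs_ne_zero.2 h
  have : ((2 * (k : ℝ) + n) * |lam| / |lam| - n) / 2 = k := by
    field_simp; ring
  simp only [fanIndex, fanPoint, this, Nat.floor_natCast]

/-- The constant `c_{n,k} = k! (n-1)! / (k+n-1)!`. -/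
def cst (n k : ℕ) : ℝ :=
  (k.factorial : ℝ) * ((n - 1).factorial : ℝ) / ((k + (n - 1)).factorial : ℝ)

/-- The normalized Strichartz Fourier transform of an integrable function on `ℍⁿ`, as a function on
`Ω × ℂⁿ`: `c_{n,k} ∫ u(z,t) e_a((z,t)⁻¹(w,0)) dz dt` for `a ∈ R_k`, and the integral against the
Bessel spherical function for `a = (0,τ) ∈ R_∞`. -/
def strichartz {n : ℕ} (u : Heis n → ℂ) (x : fan n × (Fin n → ℂ)) : ℂ :=
  if x.1.1.1 ≠ 0 then
    (cst n (fanIndex x.1) : ℂ) *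
      ∫ p : Heis n, u p * eigenFun n (fanIndex x.1) x.1.1.1 (mul (inv p) (x.2, 0))
  else
    ∫ p : Heis n,
      u p * (besselSpherical n (Real.sqrt x.1.1.2 * Real.sqrt (normSq (x.2 - p.1))) : ℂ)

/-- The measure `ν₂` on the fan:
`∫ φ dν₂ = (2π)^{-2n-1} ∫_ℝ ∑_k c_{n,k}^{-2} φ(λ,(2k+n)|λ|) |λ|^{2n} dλ`. -/
def fanMeasure (n : ℕ) : Measure (fan n) :=
  Measure.sum fun k : ℕ =>
    ((volume : Measure ℝ).withDensity fun lam =>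
      ENNReal.ofReal (((2 * Real.pi) ^ (2 * n + 1))⁻¹ * (cst n k ^ 2)⁻¹ * |lam| ^ (2 * n))).map
      (fanPoint n k)

/-- The measure `dν₂ dw` on `Ω × ℂⁿ`. -/
def specMeasure (n : ℕ) : Measure (fan n × (Fin n → ℂ)) := (fanMeasure n).prod volume

/-- `g ∈ L²(Ω × ℂⁿ, dν₂ dw)` is the normalized Strichartz Fourier transform of `f ∈ L²(ℍⁿ)`:
the transform on `L²` is the continuous extension of `strichartz` from `L¹ ∩ L²`, that is, its
graph is the closure of the graph of `strichartz` on `L¹ ∩ L²`. -/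
def IsStrichartzTransform {n : ℕ} (f : Lp ℂ 2 (volume : Measure (Heis n)))
    (g : Lp ℂ 2 (specMeasure n)) : Prop :=
  (f, g) ∈ closure {p : Lp ℂ 2 (volume : Measure (Heis n)) × Lp ℂ 2 (specMeasure n) |
    MemLp p.1 1 volume ∧ p.2 =ᵐ[specMeasure n] strichartz p.1}

/-- `h = P_W f`, where `P_W f = F⁻¹(χ_{W × ℂⁿ} F f)` and `F` is the normalized Strichartz Fourier
transform on `L²(ℍⁿ)`. -/
def IsBandProjection {n : ℕ} (W : Set (fan n))
    (f h : Lp ℂ 2 (volume : Measure (Heis n))) : Prop :=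
  ∃ g g' : Lp ℂ 2 (specMeasure n), IsStrichartzTransform f g ∧ IsStrichartzTransform h g' ∧
    g' =ᵐ[specMeasure n] (W ×ˢ (Set.univ : Set (Fin n → ℂ))).indicator g

/-- `f` is `ε`-time-limited on `V`: `‖P_{Vᶜ} f‖₂ ≤ ε ‖f‖₂`, where `P_{Vᶜ} f = χ_{Vᶜ} f`. -/
def IsTimeLimited {n : ℕ} (ε : ℝ) (V : Set (Heis n))
    (f : Lp ℂ 2 (volume : Measure (Heis n))) : Prop :=
  eLpNorm (Vᶜ.indicator f) 2 volume ≤ ENNReal.ofReal ε * eLpNorm f 2 volume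

/-- `f` is `ε`-band-limited on `W`: `‖P_{Wᶜ} f‖₂ ≤ ε ‖f‖₂`. -/
def IsBandLimited {n : ℕ} (ε : ℝ) (W : Set (fan n))
    (f : Lp ℂ 2 (volume : Measure (Heis n))) : Prop :=
  ∃ h : Lp ℂ 2 (volume : Measure (Heis n)), IsBandProjection Wᶜ f h ∧ ‖h‖ ≤ ε * ‖f‖

end StrichartzHeisenberg

end

noncomputable section

namespace StrichartzHeisenberg

/-! ### Laguerre polynomials and their generating function -/

/-! Put U = χ_V f, g = Ff, G = FU, A = W × ℂⁿ and q = χ_A G. Off A, g - q is the transform of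
P_{Wᶜ}f, and on A it is g - G. These pieces have disjoint supports, so isometry of F gives ‖g - q‖²
≤ (ε_W² + ε_V²)‖f‖², hence ‖q‖ ≥ (1 - √(ε_V² + ε_W²))‖f‖ (`one_sub_sqrt_mul_norm_le`).

In the other direction, Cauchy–Schwarz on V bounds ∫|FU(a,w)|² dw on the ray R_k by c_{n,k}² ‖f‖²
|V| ‖φ_{k,λ}‖² = c_{n,k} (2π/|λ|)ⁿ |V| ‖f‖². Since c_{n,k} ≤ 1 and |λ| > M on W, integration over W
gives ‖q‖² ≤ (2π/M)ⁿ |V| |W| ‖f‖² (`setLIntegral_strichartz_indicator_le`). Comparing the two bounds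
and cancelling ‖f‖² is the theorem.

Most of the work is the isometry on L¹ ∩ L² (`lintegral_enorm_sq_strichartz`). A Fourier transform
in t turns F into the λ-twisted convolutions g ×_λ φ_k, so with Plancherel on the line it suffices
that ∑ₖ ‖g ×_λ φ_k‖² = (2π/|λ|)²ⁿ ‖g‖² (`tsum_lintegral_twistedConv`). The generating function ∑ₖ rᵏ
φ_k is a Gaussian, and the Gaussians with parameters r and s have twisted convolution proportional
to the one with parameter rs. Comparing coefficients gives φ_k ×_λ φ_k = (2π/|λ|)ⁿ φ_k
(`integral_laguerreFun_twist`). Completeness is Abel summation: as r → 1 the Gaussian becomes a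
multiple of an approximate identity, and nonnegativity of the terms removes the factors rᵏ. -/

lemma laguerre_zero (δ k : ℕ) : laguerre δ k 0 = ((k + δ).choose k : ℝ) := by
  rw [laguerre, Finset.sum_eq_single 0]
  · simp
  · intro i _ hi
    simp [hi]
  · simp

lemma abs_laguerre_le (δ k : ℕ) {x : ℝ} (hx : 0 ≤ x) :
    |laguerre δ k x| ≤ laguerre δ k (-x) := by
  refine (Finset.abs_sum_le_sum_abs _ _).trans (Finset.sum_le_sum fun i _ => le_of_eq ?_)
  have h : (-1 : ℝ) ^ i * (-x) ^ i = x ^ i := by rw [← mul_pow]; simp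
  rw [abs_div, abs_mul, abs_mul, abs_pow, abs_pow, abs_neg, abs_one, one_pow, abs_of_nonneg hx,
    Nat.abs_cast, Nat.abs_cast, ← h]
  ring

/-- Writing k = i + m makes this a double series with terms (-xr)ⁱ/i! · binom(m+i+δ, i+δ) rᵐ. The
sum over m is a negative binomial series, equal to (1-r)^{-(i+δ+1)}, and the remaining sum over i is
exponential. -/
lemma laguerre_hasSum (δ : ℕ) (x : ℝ) {r : ℝ} (hr : |r| < 1) :
    HasSum (fun k : ℕ => r ^ k * laguerre δ k x)
      (((1 - r) ^ (δ + 1))⁻¹ * Real.exp (-(x * r / (1 - r)))) := by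
  set F : ℕ × ℕ → ℝ := fun p => ((-x) * r) ^ p.1 / (p.1.factorial : ℝ) *
    (((p.2 + (p.1 + δ)).choose (p.1 + δ) : ℝ) * r ^ p.2) with hF
  have key : ∀ (y s : ℝ), |s| < 1 → ∀ i : ℕ, HasSum (fun m : ℕ => (y * s) ^ i / (i.factorial : ℝ) *
      (((m + (i + δ)).choose (i + δ) : ℝ) * s ^ m))
      (((1 - s) ^ (δ + 1))⁻¹ * ((i.factorial : ℝ)⁻¹ * (y * s / (1 - s)) ^ i)) := by
    intro y s hs i
    have hs1 : 1 - s ≠ 0 := by have := (abs_lt.1 hs).2; linarith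
    have := (hasSum_choose_mul_geometric_of_norm_lt_one (𝕜 := ℝ) (i + δ) (r := s)
      (by simpa using hs)).mul_left ((y * s) ^ i / (i.factorial : ℝ))
    convert! this using 1
    rw [div_pow, show i + δ + 1 = i + (δ + 1) by ring, pow_add (1 - s) i]
    field_simp
  have hexp : ∀ y : ℝ, HasSum (fun i : ℕ => ((i.factorial : ℝ)⁻¹ * y ^ i)) (Real.exp y) := by
    intro y
    simpa [Real.exp_eq_exp_ℝ, smul_eq_mul] using NormedSpace.exp_series_hasSum_exp' (𝕂 := ℝ) y
  have hnorm : ∀ p, ‖F p‖ = (|x| * |r|) ^ p.1 / (p.1.factorial : ℝ) *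
    (((p.2 + (p.1 + δ)).choose (p.1 + δ) : ℝ) * |r| ^ p.2) := by
    intro p
    simp [hF]
  -- The norms form the same double series at (-|x|, |r|), so the evaluation in `key` also gives
  -- absolute summability.
  have hsum : Summable F := by
    apply Summable.of_norm
    rw [summable_prod_of_nonneg fun _ => norm_nonneg _]
    simp_rw [hnorm]
    refine ⟨fun i => (key |x| |r| (by simpa using hr) i).summable, ?_⟩
    simp_rw [fun i => (key |x| |r| (by simpa using hr) i).tsum_eq]
    exact (hexp _).summable.mul_left _
  have h1 : HasSum F (((1 - r) ^ (δ + 1))⁻¹ * Real.exp (-(x * r / (1 - r)))) := by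
    have h2 := hsum.hasSum.prod_fiberwise (fun i => key (-x) r hr i)
    have h3 := (hexp (-x * r / (1 - r))).mul_left (((1 - r) ^ (δ + 1))⁻¹)
    rw [show -(x * r / (1 - r)) = -x * r / (1 - r) by ring, ← h2.unique h3]
    exact hsum.hasSum
  -- Regrouping along the antidiagonals i + m = k recovers the Laguerre polynomials.
  have h4 := (Finset.HasAntidiagonal.sigmaAntidiagonalEquivProd (A := ℕ)).hasSum_iff.2 h1
  have h5 := h4.sigma (g := fun k : ℕ => r ^ k * laguerre δ k x) (fun k => by
    have h6 := hasSum_fintype fun p : Finset.HasAntidiagonal.antidiagonal k => F p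
    convert! h6 using 1
    rw [Finset.sum_coe_sort (Finset.HasAntidiagonal.antidiagonal k) (fun p => F p),
      Finset.Nat.sum_antidiagonal_eq_sum_range_succ_mk, laguerre, Finset.mul_sum]
    refine Finset.sum_congr rfl fun i hi => ?_
    have hik : i ≤ k := Nat.lt_succ_iff.1 (Finset.mem_range.1 hi)
    have hc : (k + δ).choose (k - i) = (k - i + (i + δ)).choose (i + δ) := by
      rw [show k + δ = k - i + (i + δ) by omega, Nat.choose_symm_add]
    have hp : r ^ k = r ^ i * r ^ (k - i) := by rw [← pow_add]; congr 1; omega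
    simp only [hF, hc, hp, mul_pow, neg_pow x]
    ring)
  exact h5

lemma inv_cst (n k : ℕ) : (cst n k)⁻¹ = ((k + (n - 1)).choose k : ℝ) := by
  rw [cst, Nat.cast_choose ℝ (Nat.le_add_right k (n - 1)), Nat.add_sub_cancel_left, inv_div]

lemma cst_pos (n k : ℕ) : 0 < cst n k := by unfold cst; positivity

lemma cst_le_one (n k : ℕ) : cst n k ≤ 1 := by
  have h : (1 : ℝ) ≤ (cst n k)⁻¹ := by
    rw [inv_cst]
    exact_mod_cast Nat.choose_pos (Nat.le_add_right _ _)
  exact (one_le_inv₀ (cst_pos n k)).1 h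

lemma normSq_nonneg {n : ℕ} (z : Fin n → ℂ) : 0 ≤ normSq z :=
  Finset.sum_nonneg fun _ _ => by positivity

lemma normSq_zero {n : ℕ} : normSq (0 : Fin n → ℂ) = 0 := by simp [normSq]

lemma normSq_neg {n : ℕ} (z : Fin n → ℂ) : normSq (-z) = normSq z := by simp [normSq]

lemma normSq_smul {n : ℕ} (c : ℝ) (z : Fin n → ℂ) : normSq (c • z) = c ^ 2 * normSq z := by
  simp [normSq, Finset.mul_sum, mul_pow]

lemma continuous_normSq {n : ℕ} : Continuous (normSq : (Fin n → ℂ) → ℝ) := by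
  unfold normSq; fun_prop

/-- The Gaussian `∑ₖ rᵏ φ_{k,λ}^{n-1}`. -/
def laguerreGaussian (n : ℕ) (r lam : ℝ) (z : Fin n → ℂ) : ℝ :=
  ((1 - r) ^ n)⁻¹ * Real.exp (-(|lam| / 4 * ((1 + r) / (1 - r)) * normSq z))

lemma laguerreFun_hasSum {n : ℕ} (hn : 1 ≤ n) (lam : ℝ) (z : Fin n → ℂ) {r : ℝ} (hr : |r| < 1) :
    HasSum (fun k : ℕ => r ^ k * laguerreFun n k lam z) (laguerreGaussian n r lam z) := by
  have hr1 : 1 - r ≠ 0 := by have := (abs_lt.1 hr).2; linarith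
  have h := (laguerre_hasSum (n - 1) ((1 / 2) * |lam| * normSq z) hr).mul_right
    (Real.exp (-((1 / 4) * |lam| * normSq z)))
  convert! h using 1
  · funext k; rw [laguerreFun]; ring
  · rw [laguerreGaussian, mul_assoc _ (Real.exp _) (Real.exp _), ← Real.exp_add,
      Nat.sub_add_cancel hn]
    congr 2
    field_simp
    ring

/-- At -x all terms of the generating series are nonnegative, so each is at most the sum; r = 1/4
costs 4ᵏ and e^{x/3}. With x = |λ||z|²/2, the factor e^{-x/2} leaves e^{-x/6}. The bound is crude in
k but keeps Gaussian decay, which makes φ_k integrable. -/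
lemma abs_laguerreFun_le {n : ℕ} (hn : 1 ≤ n) (k : ℕ) (lam : ℝ) (z : Fin n → ℂ) :
    |laguerreFun n k lam z| ≤ 4 ^ k * ((4 / 3) ^ n * Real.exp (-(|lam| / 12 * normSq z))) := by
  set x := (1 / 2) * |lam| * normSq z with hx
  have hx0 : 0 ≤ x := by have := normSq_nonneg z; positivity
  have hr : |(1 / 4 : ℝ)| < 1 := by norm_num [abs_lt]
  have h := laguerre_hasSum (n - 1) (-x) hr
  have hnn : ∀ j, 0 ≤ laguerre (n - 1) j (-x) := fun j =>
    (abs_nonneg _).trans (abs_laguerre_le _ _ hx0)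
  have h1 := le_hasSum h k fun j _ => mul_nonneg (by positivity) (hnn j)
  rw [Nat.sub_add_cancel hn] at h1
  have h2 : laguerre (n - 1) k (-x) ≤ 4 ^ k * ((4 / 3) ^ n * Real.exp (x / 3)) := by
    have h3 : laguerre (n - 1) k (-x) = 4 ^ k * ((1 / 4) ^ k * laguerre (n - 1) k (-x)) := by
      rw [← mul_assoc, ← mul_pow]; norm_num
    rw [h3]
    refine mul_le_mul_of_nonneg_left (h1.trans (le_of_eq ?_)) (by positivity)
    rw [← inv_pow]
    norm_num
    ring
  rw [laguerreFun, abs_mul, abs_of_pos (Real.exp_pos _)]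
  calc _ ≤ (4 ^ k * ((4 / 3) ^ n * Real.exp (x / 3))) *
        Real.exp (-((1 / 4) * |lam| * normSq z)) :=
        mul_le_mul_of_nonneg_right ((abs_laguerre_le _ _ hx0).trans h2) (Real.exp_pos _).le
    _ = _ := by
        rw [mul_assoc, mul_assoc, ← Real.exp_add]
        congr 3
        rw [hx]; ring

lemma laguerreFun_zero (n k : ℕ) (lam : ℝ) :
    laguerreFun n k lam 0 = (cst n k)⁻¹ := by
  rw [inv_cst, laguerreFun, normSq_zero]
  simp [laguerre_zero]

lemma laguerreFun_neg (n k : ℕ) (lam : ℝ) (z : Fin n → ℂ) :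
    laguerreFun n k lam (-z) = laguerreFun n k lam z := by
  rw [laguerreFun, normSq_neg, laguerreFun]

lemma laguerreFun_sub_comm (n k : ℕ) (lam : ℝ) (z w : Fin n → ℂ) :
    laguerreFun n k lam (z - w) = laguerreFun n k lam (w - z) := by
  rw [← laguerreFun_neg, neg_sub]

lemma continuous_laguerreFun_uncurry (n k : ℕ) :
    Continuous (fun q : ℝ × (Fin n → ℂ) => laguerreFun n k q.1 q.2) := by
  have h : Continuous fun q : ℝ × (Fin n → ℂ) => |q.1| * normSq q.2 :=
    continuous_fst.abs.mul (continuous_normSq.comp continuous_snd)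
  have h' : Continuous (laguerre (n - 1) k) := by unfold laguerre; fun_prop
  simp only [laguerreFun, mul_assoc]
  exact (h'.comp (continuous_const.mul h)).mul
    (Real.continuous_exp.comp (continuous_const.mul h).neg)

lemma continuous_laguerreFun (n k : ℕ) (lam : ℝ) :
    Continuous (laguerreFun n k lam) :=
  (continuous_laguerreFun_uncurry n k).comp (f := fun z : Fin n → ℂ => (lam, z)) (by fun_prop)

/-! ### Gaussian integrals on `ℂⁿ` with a symplectic phase -/

/-- The symplectic form `Im (z · w̄)` on `ℂⁿ`. -/
def symp {n : ℕ} (z w : Fin n → ℂ) : ℝ := (∑ j, z j * (starRingEnd ℂ) (w j)).im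

lemma symp_eq_sum {n : ℕ} (z w : Fin n → ℂ) :
    symp z w = ∑ j, ((z j).im * (w j).re - (z j).re * (w j).im) := by
  rw [symp, Complex.im_sum]
  refine Finset.sum_congr rfl fun j _ => ?_
  simp [Complex.mul_im]; ring

lemma symp_swap {n : ℕ} (z w : Fin n → ℂ) : symp w z = -symp z w := by
  simp only [symp_eq_sum, ← Finset.sum_neg_distrib]
  exact Finset.sum_congr rfl fun j _ => by ring

lemma symp_self {n : ℕ} (z : Fin n → ℂ) : symp z z = 0 := by
  have := symp_swap z z; linarith

lemma symp_add_right {n : ℕ} (z w w' : Fin n → ℂ) : symp z (w + w') = symp z w + symp z w' := by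
  simp only [symp_eq_sum, ← Finset.sum_add_distrib]
  exact Finset.sum_congr rfl fun j _ => by simp; ring

lemma symp_neg_left {n : ℕ} (z w : Fin n → ℂ) : symp (-z) w = -symp z w := by
  simp only [symp_eq_sum, ← Finset.sum_neg_distrib]
  exact Finset.sum_congr rfl fun j _ => by simp; ring

lemma symp_neg_right {n : ℕ} (z w : Fin n → ℂ) : symp z (-w) = -symp z w := by
  rw [symp_swap, symp_neg_left, symp_swap, neg_neg]

lemma symp_zero_left {n : ℕ} (w : Fin n → ℂ) : symp 0 w = 0 := by simp [symp]

lemma continuous_symp {n : ℕ} :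
    Continuous fun q : (Fin n → ℂ) × (Fin n → ℂ) => symp q.1 q.2 := by
  unfold symp
  refine Complex.continuous_im.comp (continuous_finsetSum _ fun j _ => ?_)
  exact ((continuous_apply j).comp continuous_fst).mul
    (Complex.continuous_conj.comp ((continuous_apply j).comp continuous_snd))

/-- The phase `exp (-½ i λ Im (z · w̄))` of the `λ`-twisted convolution. -/
def phase {n : ℕ} (lam : ℝ) (z w : Fin n → ℂ) : ℂ :=
  Complex.exp (((-(lam / 2 * symp z w) : ℝ) : ℂ) * Complex.I)

lemma norm_phase {n : ℕ} (lam : ℝ) (z w : Fin n → ℂ) : ‖phase lam z w‖ = 1 :=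
  Complex.norm_exp_ofReal_mul_I _

lemma continuous_phase {n : ℕ} :
    Continuous fun q : ℝ × (Fin n → ℂ) × (Fin n → ℂ) => phase q.1 q.2.1 q.2.2 := by
  have h : Continuous fun q : ℝ × (Fin n → ℂ) × (Fin n → ℂ) => symp q.2.1 q.2.2 :=
    continuous_symp.comp continuous_snd
  unfold phase
  fun_prop

lemma conj_phase {n : ℕ} (lam : ℝ) (z w : Fin n → ℂ) :
    (starRingEnd ℂ) (phase lam z w) = phase lam (-z) w := by
  rw [phase, phase, ← Complex.exp_conj, symp_neg_left, map_mul, Complex.conj_ofReal, Complex.conj_I]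
  congr 1
  push_cast
  ring

lemma integral_cexp_neg_mul_normSq_add {b : ℝ} (hb : 0 < b) (c d : ℂ) :
    ∫ z : ℂ, Complex.exp (-(b * (‖z‖ ^ 2 : ℝ)) + (c * z.re + d * z.im)) =
      (Real.pi / b) * Complex.exp ((c ^ 2 + d ^ 2) / (4 * b)) := by
  have hb' : (b : ℂ) ≠ 0 := by exact_mod_cast hb.ne'
  rw [← Complex.volume_preserving_equiv_real_prod.symm.integral_comp']
  have h : ∀ p : ℝ × ℝ, Complex.exp (-(b * (‖Complex.measurableEquivRealProd.symm p‖ ^ 2 : ℝ)) +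
      (c * (Complex.measurableEquivRealProd.symm p).re +
        d * (Complex.measurableEquivRealProd.symm p).im)) =
      Complex.exp ((-b : ℂ) * p.1 ^ 2 + c * p.1 + 0) *
        Complex.exp ((-b : ℂ) * p.2 ^ 2 + d * p.2 + 0) := by
    intro p
    rw [← Complex.exp_add, ← Complex.normSq_eq_norm_sq, Complex.normSq_apply]
    simp only [Complex.measurableEquivRealProd_symm_apply]
    congr 1
    push_cast
    ring
  simp_rw [h]
  rw [Measure.volume_eq_prod,
    integral_prod_mul (fun x : ℝ => Complex.exp ((-b : ℂ) * x ^ 2 + c * x + 0))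
    (fun x : ℝ => Complex.exp ((-b : ℂ) * x ^ 2 + d * x + 0)),
    integral_cexp_quadratic (by simpa using hb), integral_cexp_quadratic (by simpa using hb)]
  have hs : ((Real.pi : ℂ) / - -b) ^ (1 / 2 : ℂ) * ((Real.pi : ℂ) / - -b) ^ (1 / 2 : ℂ) =
      Real.pi / b := by
    rw [neg_neg, ← Complex.cpow_add _ _ (div_ne_zero (by exact_mod_cast Real.pi_ne_zero) hb')]
    norm_num
  rw [mul_mul_mul_comm, hs, ← Complex.exp_add]
  congr 2
  field_simp
  ring

/-- The integrand factors over the coordinates into Gaussians with a complex linear term. In the sum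
of the two squared linear coefficients the imaginary cross terms cancel, leaving (4β² - λ²/4)|w_j|²,
so the result is a real Gaussian. -/
lemma integral_gaussian_mul_phase {n : ℕ} {α β : ℝ} (hα : 0 < α) (hβ : 0 < β) (lam : ℝ)
    (w : Fin n → ℂ) :
    ∫ z : Fin n → ℂ, (Real.exp (-(α * normSq z)) : ℂ) *
        (Real.exp (-(β * normSq (w - z))) : ℂ) * phase lam z w =
      (((Real.pi / (α + β)) ^ n *
        Real.exp (-((α * β + lam ^ 2 / 16) / (α + β) * normSq w)) : ℝ) : ℂ) := by
  have hb : 0 < α + β := by positivity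
  have hb' : (α : ℂ) + β ≠ 0 := by exact_mod_cast hb.ne'
  have h : ∀ z : Fin n → ℂ, (Real.exp (-(α * normSq z)) : ℂ) *
      (Real.exp (-(β * normSq (w - z))) : ℂ) * phase lam z w =
      ∏ j, (Complex.exp (-(β * (‖w j‖ ^ 2 : ℝ))) *
        Complex.exp (-((α + β : ℝ) * (‖z j‖ ^ 2 : ℝ)) +
        ((2 * β * (w j).re + lam / 2 * (w j).im * Complex.I) * (z j).re +
         (2 * β * (w j).im - lam / 2 * (w j).re * Complex.I) * (z j).im))) := by
    intro z
    simp only [← Complex.exp_add, ← Complex.exp_sum, phase, Complex.ofReal_exp]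
    congr 1
    simp only [symp_eq_sum, normSq, Finset.mul_sum, ← Finset.sum_neg_distrib, Complex.ofReal_sum,
      Finset.sum_mul, ← Finset.sum_add_distrib]
    refine Finset.sum_congr rfl fun j _ => ?_
    simp only [← Complex.normSq_eq_norm_sq, Complex.normSq_apply, Pi.sub_apply, Complex.sub_re,
      Complex.sub_im]
    push_cast
    ring
  simp_rw [h]
  rw [integral_fintype_prod_volume_eq_prod (fun j (x : ℂ) => Complex.exp (-(β * (‖w j‖ ^ 2 : ℝ))) *
        Complex.exp (-((α + β : ℝ) * (‖x‖ ^ 2 : ℝ)) +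
        ((2 * β * (w j).re + lam / 2 * (w j).im * Complex.I) * x.re +
         (2 * β * (w j).im - lam / 2 * (w j).re * Complex.I) * x.im)))]
  simp_rw [integral_const_mul, integral_cexp_neg_mul_normSq_add hb]
  have h2 : ∀ j, Complex.exp (-(β * (‖w j‖ ^ 2 : ℝ))) * (Real.pi / (α + β : ℝ) *
      Complex.exp (((2 * β * (w j).re + lam / 2 * (w j).im * Complex.I) ^ 2 +
        (2 * β * (w j).im - lam / 2 * (w j).re * Complex.I) ^ 2) / (4 * (α + β : ℝ)))) =
      Real.pi / (α + β : ℝ) *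
        Complex.exp (-((α * β + lam ^ 2 / 16) / (α + β) * (‖w j‖ ^ 2 : ℝ))) := by
    intro j
    rw [mul_left_comm, ← Complex.exp_add]
    congr 2
    simp only [← Complex.normSq_eq_norm_sq, Complex.normSq_apply]
    push_cast
    field_simp
    ring_nf
    simp only [Complex.I_sq]
    ring
  simp_rw [h2]
  rw [Finset.prod_mul_distrib, Finset.prod_const, Finset.card_univ, Fintype.card_fin,
    ← Complex.exp_sum, normSq]
  push_cast
  rw [Finset.mul_sum, Finset.sum_neg_distrib]

lemma exp_neg_mul_normSq_eq_prod {n : ℕ} (b : ℝ) (z : Fin n → ℂ) :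
    Real.exp (-(b * normSq z)) = ∏ j, Real.exp (-b * ‖z j‖ ^ 2) := by
  rw [← Real.exp_sum, normSq, Finset.mul_sum, ← Finset.sum_neg_distrib]
  congr 1
  exact Finset.sum_congr rfl fun j _ => by ring

lemma integrable_exp_neg_mul_normSq {n : ℕ} {b : ℝ} (hb : 0 < b) :
    Integrable fun z : Fin n → ℂ => Real.exp (-(b * normSq z)) := by
  simp_rw [exp_neg_mul_normSq_eq_prod]
  refine Integrable.fintype_prod (f := fun _ (x : ℂ) => Real.exp (-b * ‖x‖ ^ 2)) fun j => ?_
  have := (GaussianFourier.integrable_cexp_neg_mul_sq_norm_add (V := ℂ) (b := b) (by simpa using hb)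
    0 0).norm
  refine this.congr (Filter.Eventually.of_forall fun x => ?_)
  simp only [zero_mul, add_zero, Complex.norm_exp]
  congr 1
  norm_cast

lemma integral_exp_neg_mul_normSq {n : ℕ} {b : ℝ} (hb : 0 < b) :
    ∫ z : Fin n → ℂ, Real.exp (-(b * normSq z)) = (Real.pi / b) ^ n := by
  -- With w = 0 and λ = 0 the phase is trivial, and the two Gaussians of rate b/2 combine to rate b.
  have h := integral_gaussian_mul_phase (n := n) (half_pos hb) (half_pos hb) 0 0
  have h2 : ∀ z : Fin n → ℂ, (Real.exp (-(b / 2 * normSq z)) : ℂ) *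
      (Real.exp (-(b / 2 * normSq (0 - z))) : ℂ) * phase 0 z 0 =
      ((Real.exp (-(b * normSq z)) : ℝ) : ℂ) := by
    intro z
    rw [zero_sub, normSq_neg, phase, ← Complex.ofReal_mul, ← Real.exp_add]
    simp only [zero_div, zero_mul, neg_zero, Complex.ofReal_zero, Complex.exp_zero, mul_one]
    congr 2; ring
  simp_rw [h2] at h
  rw [integral_complex_ofReal] at h
  have h3 := Complex.ofReal_injective h
  rw [h3, normSq_zero]
  simp

/-! ### Twisted convolution of Laguerre functions -/

/-- Uniqueness of power series coefficients; this is how identities between Gaussians become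
identities between Laguerre functions. -/
lemma eq_of_hasSum_pow_mul {a b : ℕ → ℂ} {ε : ℝ} (hε : 0 < ε) (f : ℝ → ℂ)
    (ha : ∀ r : ℝ, |r| < ε → HasSum (fun k => (r : ℂ) ^ k * a k) (f r))
    (hb : ∀ r : ℝ, |r| < ε → HasSum (fun k => (r : ℂ) ^ k * b k) (f r)) : a = b := by
  let p : (ℕ → ℂ) → FormalMultilinearSeries ℝ ℝ ℂ :=
    fun c k => ContinuousMultilinearMap.mkPiRing ℝ (Fin k) (c k)
  have key : ∀ c : ℕ → ℂ, (∀ r : ℝ, |r| < ε → HasSum (fun k => (r : ℂ) ^ k * c k) (f r)) →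
      HasFPowerSeriesAt f (p c) 0 := by
    intro c hc
    refine hasFPowerSeriesAt_iff.2 ?_
    filter_upwards [Metric.ball_mem_nhds (0 : ℝ) hε] with r hr
    have := hc r (by simpa using hr)
    simpa [p, FormalMultilinearSeries.coeff] using this
  have h := (key a ha).eq_formalMultilinearSeries (key b hb)
  funext k
  have := congrArg (fun p : FormalMultilinearSeries ℝ ℝ ℂ => p.coeff k) h
  simpa [p, FormalMultilinearSeries.coeff] using this

lemma laguerreGaussian_nonneg {n : ℕ} {r : ℝ} (hr : |r| < 1) (lam : ℝ) (z : Fin n → ℂ) :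
    0 ≤ laguerreGaussian n r lam z := by
  have : 0 < 1 - r := by have := (abs_lt.1 hr).2; linarith
  unfold laguerreGaussian; positivity

lemma continuous_laguerreGaussian (n : ℕ) (r lam : ℝ) :
    Continuous (laguerreGaussian n r lam) := by
  have := continuous_normSq (n := n)
  unfold laguerreGaussian; fun_prop

lemma gaussian_rate_pos {r : ℝ} (hr : |r| < 1) {lam : ℝ} (hl : lam ≠ 0) :
    0 < |lam| / 4 * ((1 + r) / (1 - r)) := by
  have h1 : 0 < 1 - r := by have := (abs_lt.1 hr).2; linarith
  have h2 : 0 < 1 + r := by have := (abs_lt.1 hr).1; linarith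
  positivity

lemma integrable_laguerreGaussian {n : ℕ} {r : ℝ} (hr : |r| < 1) {lam : ℝ} (hl : lam ≠ 0) :
    Integrable (laguerreGaussian n r lam) :=
  (integrable_exp_neg_mul_normSq (gaussian_rate_pos hr hl)).const_mul _

lemma integrable_laguerreFun {n : ℕ} (hn : 1 ≤ n) (k : ℕ) {lam : ℝ} (hl : lam ≠ 0) :
    Integrable (laguerreFun n k lam) := by
  have h : Integrable fun z : Fin n → ℂ =>
      4 ^ k * ((4 / 3) ^ n * Real.exp (-(|lam| / 12 * normSq z))) :=
    ((integrable_exp_neg_mul_normSq (by positivity)).const_mul _).const_mul _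
  refine h.mono' (continuous_laguerreFun n k lam).aestronglyMeasurable
    (Filter.Eventually.of_forall fun z => ?_)
  exact abs_laguerreFun_le hn k lam z

lemma abs_laguerreFun_le_const {n : ℕ} (hn : 1 ≤ n) (k : ℕ) (lam : ℝ) (z : Fin n → ℂ) :
    |laguerreFun n k lam z| ≤ 4 ^ k * (4 / 3) ^ n := by
  refine (abs_laguerreFun_le hn k lam z).trans ?_
  have h : Real.exp (-(|lam| / 12 * normSq z)) ≤ 1 :=
    Real.exp_le_one_iff.2 (by have := normSq_nonneg z; have := abs_nonneg lam; nlinarith)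
  gcongr
  exact mul_le_of_le_one_right (by positivity) h

lemma integrable_laguerreFun_sq {n : ℕ} (hn : 1 ≤ n) (k : ℕ) {lam : ℝ} (hl : lam ≠ 0) :
    Integrable fun z => laguerreFun n k lam z ^ 2 := by
  simp_rw [sq]
  exact (integrable_laguerreFun hn k hl).bdd_mul
    (continuous_laguerreFun n k lam).aestronglyMeasurable
    (Filter.Eventually.of_forall fun z => abs_laguerreFun_le_const hn k lam z)

/-- Termwise integration of the generating series. The bound `B` is left free: 4ᵏ(4/3)ⁿ serves for
|s| < 1/4, and the sharp `(cst n k)⁻¹`, available only later, for all |s| < 1. -/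
lemma hasSum_integral_mul_laguerreFun {α : Type*} [MeasurableSpace α] {μ : Measure α} {n : ℕ}
    (hn : 1 ≤ n) {lam : ℝ} {K : α → ℂ} (hK : Integrable K μ) {T : α → Fin n → ℂ}
    (hT : Measurable T) {B : ℕ → ℝ} (hB : ∀ k z, |laguerreFun n k lam z| ≤ B k) {s : ℝ}
    (hs : |s| < 1) (hsum : Summable fun k => |s| ^ k * B k) :
    HasSum (fun k => (s : ℂ) ^ k * ∫ a, K a * (laguerreFun n k lam (T a) : ℂ) ∂μ)
      (∫ a, K a * (laguerreGaussian n s lam (T a) : ℂ) ∂μ) := by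
  simp_rw [← integral_const_mul]
  refine hasSum_integral_of_dominated_convergence (fun k a => ‖K a‖ * (|s| ^ k * B k))
    ?_ ?_ ?_ ?_ ?_
  · intro k
    refine (hK.aestronglyMeasurable.mul (Measurable.aestronglyMeasurable ?_)).const_mul _
    exact Complex.measurable_ofReal.comp ((continuous_laguerreFun n k lam).measurable.comp hT)
  · intro k
    refine Filter.Eventually.of_forall fun a => ?_
    rw [norm_mul, norm_mul, norm_pow, Complex.norm_real, Complex.norm_real, Real.norm_eq_abs,
      Real.norm_eq_abs, mul_left_comm]
    gcongr
    exact hB k _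
  · exact Filter.Eventually.of_forall fun a => hsum.mul_left _
  · simp_rw [tsum_mul_left]
    exact hK.norm.mul_const _
  · refine Filter.Eventually.of_forall fun a => ?_
    have h := (Complex.hasSum_ofReal.2 (laguerreFun_hasSum hn lam (T a) hs)).mul_left (K a)
    convert! h using 2
    push_cast; ring

lemma summable_abs_pow_mul_four_pow {s : ℝ} (hs : |s| < 1 / 4) (c : ℝ) :
    Summable fun k : ℕ => |s| ^ k * (4 ^ k * c) := by
  simp_rw [← mul_assoc, ← mul_pow]
  exact (summable_geometric_of_lt_one (by positivity) (by linarith)).mul_right c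

/-- A Mehler-type semigroup law: with r = e^{-t} the rate is |λ|/4 · coth(t/2), and the new rate (αβ
+ λ²/16)/(α + β) is the addition formula for coth. -/
lemma integral_laguerreGaussian_twist {n : ℕ} {r s : ℝ} (hr : |r| < 1) (hs : |s| < 1) {lam : ℝ}
    (hl : lam ≠ 0) (y : Fin n → ℂ) :
    ∫ v, phase lam v y * (laguerreGaussian n r lam v : ℂ) * (laguerreGaussian n s lam (y - v) : ℂ) =
      ((2 * Real.pi / |lam|) ^ n * laguerreGaussian n (r * s) lam y : ℝ) := by
  have hr1 : 0 < 1 - r := by have := (abs_lt.1 hr).2; linarith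
  have hs1 : 0 < 1 - s := by have := (abs_lt.1 hs).2; linarith
  have hrs : 0 < 1 - r * s := by
    have : |r * s| < 1 := by
      rw [abs_mul]; exact mul_lt_one_of_nonneg_of_lt_one_left (abs_nonneg _) hr hs.le
    have := (abs_lt.1 this).2; linarith
  have ha : 0 < |lam| := abs_pos.2 hl
  have h := integral_gaussian_mul_phase (n := n) (gaussian_rate_pos hr hl)
    (gaussian_rate_pos hs hl) lam y
  have h2 : ∀ v, phase lam v y * (laguerreGaussian n r lam v : ℂ) *
      (laguerreGaussian n s lam (y - v) : ℂ) =
      ((((1 - r) ^ n)⁻¹ * ((1 - s) ^ n)⁻¹ : ℝ) : ℂ) *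
      ((Real.exp (-(|lam| / 4 * ((1 + r) / (1 - r)) * normSq v)) : ℂ) *
        (Real.exp (-(|lam| / 4 * ((1 + s) / (1 - s)) * normSq (y - v))) : ℂ) * phase lam v y) := by
    intro v
    rw [laguerreGaussian, laguerreGaussian]
    push_cast
    ring
  simp_rw [h2, integral_const_mul]
  rw [h, ← Complex.ofReal_mul]
  congr 1
  have hsum : |lam| / 4 * ((1 + r) / (1 - r)) + |lam| / 4 * ((1 + s) / (1 - s)) =
      |lam| * (1 - r * s) / (2 * ((1 - r) * (1 - s))) := by
    field_simp; ring
  have hprod : |lam| / 4 * ((1 + r) / (1 - r)) * (|lam| / 4 * ((1 + s) / (1 - s))) + lam ^ 2 / 16 =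
      |lam| ^ 2 * (1 + r * s) / (8 * ((1 - r) * (1 - s))) := by
    rw [← sq_abs lam]
    field_simp; ring
  have hA : ((1 - r) ^ n)⁻¹ * ((1 - s) ^ n)⁻¹ *
      (Real.pi / (|lam| * (1 - r * s) / (2 * ((1 - r) * (1 - s))))) ^ n =
      (2 * Real.pi / |lam|) ^ n * ((1 - r * s) ^ n)⁻¹ := by
    simp only [← inv_pow, ← mul_pow]
    congr 1
    field_simp
  have hB : |lam| ^ 2 * (1 + r * s) / (8 * ((1 - r) * (1 - s))) /
      (|lam| * (1 - r * s) / (2 * ((1 - r) * (1 - s)))) =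
      |lam| / 4 * ((1 + r * s) / (1 - r * s)) := by
    field_simp
    ring
  rw [hsum, hprod, laguerreGaussian, hB, ← mul_assoc, hA, mul_assoc]

/-- Both sides are read off from the semigroup law as coefficients of sᵏ and then of rᵏ. Since rs
enters only through (rs)ᵏ, off-diagonal products vanish and the diagonal ones reproduce φ_k. -/
lemma integral_laguerreFun_twist {n : ℕ} (hn : 1 ≤ n) (k : ℕ) {lam : ℝ} (hl : lam ≠ 0)
    (y : Fin n → ℂ) :
    ∫ v, phase lam v y * (laguerreFun n k lam (y - v) : ℂ) * (laguerreFun n k lam v : ℂ) =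
      ((2 * Real.pi / |lam|) ^ n * laguerreFun n k lam y : ℝ) := by
  set C : ℝ := (2 * Real.pi / |lam|) ^ n with hC
  have hph : Continuous fun v => phase lam v y :=
    continuous_phase.comp (f := fun v : Fin n → ℂ => (lam, v, y)) (by fun_prop)
  have hsub : Measurable fun v : Fin n → ℂ => y - v := by fun_prop
  have hone : ∀ {r : ℝ}, |r| < 1 / 4 → |r| < 1 := fun h => h.trans (by norm_num)
  -- First r is fixed and the coefficients of sᵏ are compared.
  have h1 : ∀ r : ℝ, |r| < 1 / 4 →
      ∫ v, phase lam v y * (laguerreGaussian n r lam v : ℂ) * (laguerreFun n k lam (y - v) : ℂ) =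
        (r : ℂ) ^ k * ((C * laguerreFun n k lam y : ℝ) : ℂ) := by
    intro r hr
    have hK : Integrable fun v => phase lam v y * (laguerreGaussian n r lam v : ℂ) :=
      (integrable_laguerreGaussian (hone hr) hl).ofReal.bdd_mul hph.aestronglyMeasurable
        (Filter.Eventually.of_forall fun v => (norm_phase _ _ _).le)
    refine congrFun (eq_of_hasSum_pow_mul (ε := 1 / 4) (by norm_num)
      (fun s => ((C * laguerreGaussian n (r * s) lam y : ℝ) : ℂ)) ?_ ?_
      (a := fun k => ∫ v, phase lam v y * (laguerreGaussian n r lam v : ℂ) *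
        (laguerreFun n k lam (y - v) : ℂ))
      (b := fun k => (r : ℂ) ^ k * ((C * laguerreFun n k lam y : ℝ) : ℂ))) k
    · intro s hs
      rw [← integral_laguerreGaussian_twist (hone hr) (hone hs) hl y]
      exact hasSum_integral_mul_laguerreFun hn hK hsub
        (fun k z => abs_laguerreFun_le_const hn k lam z) (hone hs)
        (summable_abs_pow_mul_four_pow hs _)
    · intro s hs
      have hrs : |r * s| < 1 := by
        rw [abs_mul]
        exact mul_lt_one_of_nonneg_of_lt_one_left (abs_nonneg _) (hone hr) (hone hs).le
      have h := Complex.hasSum_ofReal.2 ((laguerreFun_hasSum hn lam y hrs).mul_left C)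
      convert! h using 2
      push_cast; ring
  have hK : Integrable fun v => phase lam v y * (laguerreFun n k lam (y - v) : ℂ) :=
    ((integrable_laguerreFun hn k hl).comp_sub_left y).ofReal.bdd_mul hph.aestronglyMeasurable
        (Filter.Eventually.of_forall fun v => (norm_phase _ _ _).le)
  -- Now the power series in r: its right-hand side is the single monomial rᵏ, hence the Kronecker
  -- delta in `b`.
  have h2 := congrFun (eq_of_hasSum_pow_mul (ε := 1 / 4) (by norm_num)
      (fun r => (r : ℂ) ^ k * ((C * laguerreFun n k lam y : ℝ) : ℂ)) ?_ ?_
      (a := fun j => ∫ v, phase lam v y * (laguerreFun n k lam (y - v) : ℂ) *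
        (laguerreFun n j lam v : ℂ))
      (b := fun j => if j = k then ((C * laguerreFun n k lam y : ℝ) : ℂ) else 0)) k
  · simpa using h2
  · intro r hr
    have h3 := hasSum_integral_mul_laguerreFun hn hK measurable_id
        (fun k z => abs_laguerreFun_le_const hn k lam z) (hone hr)
        (summable_abs_pow_mul_four_pow hr _)
    rw [← h1 r hr]
    convert! h3 using 3
    simp only [id]; ring
  · intro r _
    convert! hasSum_ite_eq k ((r : ℂ) ^ k * ((C * laguerreFun n k lam y : ℝ) : ℂ)) using 2 with j
    split_ifs with h
    · rw [h]
    · simp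

lemma integral_laguerreFun_sq {n : ℕ} (hn : 1 ≤ n) (k : ℕ) {lam : ℝ} (hl : lam ≠ 0) :
    ∫ v, laguerreFun n k lam v ^ 2 = (2 * Real.pi / |lam|) ^ n * (cst n k)⁻¹ := by
  have h := integral_laguerreFun_twist hn k hl 0
  rw [laguerreFun_zero] at h
  have h2 : ∀ v, phase lam v 0 * (laguerreFun n k lam (0 - v) : ℂ) * (laguerreFun n k lam v : ℂ) =
      ((laguerreFun n k lam v ^ 2 : ℝ) : ℂ) := by
    intro v
    rw [zero_sub, laguerreFun_neg, phase, symp_swap, symp_zero_left]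
    push_cast
    simp [sq]
  simp_rw [h2] at h
  rw [integral_complex_ofReal] at h
  exact Complex.ofReal_injective h

/-- The reproducing identity and 2|ab| ≤ a² + b² bound (2π/|λ|)ⁿ |φ_k(y)| by ‖φ_k‖² = (2π/|λ|)ⁿ
c_{n,k}⁻¹. Growth is only polynomial in k, so the generating series can be integrated for every |r|
< 1, as the limit r → 1 requires. -/
lemma abs_laguerreFun_le_inv_cst {n : ℕ} (hn : 1 ≤ n) (k : ℕ) {lam : ℝ} (hl : lam ≠ 0)
    (y : Fin n → ℂ) : |laguerreFun n k lam y| ≤ (cst n k)⁻¹ := by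
  have hC : 0 < (2 * Real.pi / |lam|) ^ n := by have := Real.pi_pos; positivity
  refine le_of_mul_le_mul_left ?_ hC
  rw [← integral_laguerreFun_sq hn k hl]
  have h := congrArg norm (integral_laguerreFun_twist hn k hl y)
  rw [Complex.norm_real, Real.norm_eq_abs, abs_mul, abs_of_pos hC] at h
  rw [← h]
  have hi := integrable_laguerreFun_sq hn k hl
  have hi2 := hi.comp_sub_left y
  calc _ ≤ ∫ v, (1 / 2) * (laguerreFun n k lam v ^ 2 + laguerreFun n k lam (y - v) ^ 2) := by
        refine norm_integral_le_of_norm_le ((hi.add hi2).const_mul _)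
          (Filter.Eventually.of_forall fun v => ?_)
        rw [norm_mul, norm_mul, norm_phase, one_mul, Complex.norm_real, Complex.norm_real,
          Real.norm_eq_abs, Real.norm_eq_abs, ← sq_abs (laguerreFun n k lam v),
          ← sq_abs (laguerreFun n k lam (y - v))]
        nlinarith [sq_nonneg (|laguerreFun n k lam v| - |laguerreFun n k lam (y - v)|)]
    _ = _ := by
        rw [integral_const_mul, integral_add hi hi2,
          integral_sub_left_eq_self (fun v => laguerreFun n k lam v ^ 2) volume y]
        ring

lemma summable_abs_pow_mul_inv_cst (n : ℕ) {s : ℝ} (hs : |s| < 1) :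
    Summable fun k => |s| ^ k * (cst n k)⁻¹ := by
  have h := summable_choose_mul_geometric_of_norm_lt_one (R := ℝ) (n - 1) (r := |s|)
    (by simpa using hs)
  refine h.congr fun k => ?_
  rw [inv_cst, mul_comm, Nat.choose_symm_add]

/-! ### Twisted convolution with Laguerre functions -/

lemma continuous_phase_fixed {n : ℕ} (lam : ℝ) :
    Continuous fun q : (Fin n → ℂ) × (Fin n → ℂ) => phase lam q.1 q.2 :=
  continuous_phase.comp (f := fun q : (Fin n → ℂ) × (Fin n → ℂ) => (lam, q)) (by fun_prop)

lemma measurable_phase_comp {n : ℕ} {α : Type*} [MeasurableSpace α] {l : α → ℝ}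
    {u v : α → Fin n → ℂ} (hl : Measurable l) (hu : Measurable u) (hv : Measurable v) :
    Measurable fun a => phase (l a) (u a) (v a) :=
  continuous_phase.measurable.comp (hl.prodMk (hu.prodMk hv))

lemma measurable_laguerreFun_comp {n : ℕ} {α : Type*} [MeasurableSpace α] (k : ℕ) {l : α → ℝ}
    {u : α → Fin n → ℂ} (hl : Measurable l) (hu : Measurable u) :
    Measurable fun a => (laguerreFun n k (l a) (u a) : ℂ) := by
  have h := (continuous_laguerreFun_uncurry n k).measurable.comp (hl.prodMk hu)
  exact Complex.measurable_ofReal.comp h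

/-- The `λ`-twisted convolution `g ×_λ φ_{k,λ}^{n-1}`. -/
def twistedConv {n : ℕ} (k : ℕ) (lam : ℝ) (g : (Fin n → ℂ) → ℂ) (w : Fin n → ℂ) : ℂ :=
  ∫ z, g z * phase lam z w * (laguerreFun n k lam (w - z) : ℂ)

/-- The kernel `g(z) conj(g(w)) exp(-½ i λ Im (z · w̄))`. -/
def twistedKernel {n : ℕ} (lam : ℝ) (g : (Fin n → ℂ) → ℂ)
    (q : (Fin n → ℂ) × (Fin n → ℂ)) : ℂ :=
  g q.1 * (starRingEnd ℂ) (g q.2) * phase lam q.1 q.2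

lemma integrable_twistedKernel {n : ℕ} (lam : ℝ) {g : (Fin n → ℂ) → ℂ} (hg : Integrable g) :
    Integrable (twistedKernel lam g) := by
  have h : Integrable fun z => (starRingEnd ℂ) (g z) :=
    (Complex.conjLIE.integrable_comp_iff (φ := g)).2 hg
  exact (hg.mul_prod h).mul_bdd (c := 1) (continuous_phase_fixed lam).aestronglyMeasurable
    (Filter.Eventually.of_forall fun q => (norm_phase _ _ _).le)

lemma phase_mul_conj_phase_add {n : ℕ} (lam : ℝ) (z z' v : Fin n → ℂ) :
    phase lam z (z + v) * (starRingEnd ℂ) (phase lam z' (z + v)) =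
      phase lam z z' * phase lam v (z' - z) := by
  rw [conj_phase, phase, phase, phase, phase, ← Complex.exp_add, ← Complex.exp_add, ← add_mul,
    ← add_mul, ← Complex.ofReal_add, ← Complex.ofReal_add]
  congr 3
  rw [symp_add_right, symp_self, symp_neg_left, symp_add_right, sub_eq_add_neg, symp_add_right,
    symp_neg_right, symp_swap z z', symp_swap z' v, symp_swap z v]
  ring

/-- Translating w = z + v and using the cocycle identity for the phase reduces this to the
reproducing identity at y = z' - z. -/
lemma integral_phase_mul_laguerreFun {n : ℕ} (hn : 1 ≤ n) (k : ℕ) {lam : ℝ} (hl : lam ≠ 0)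
    (z z' : Fin n → ℂ) :
    ∫ w, phase lam z w * (starRingEnd ℂ) (phase lam z' w) *
        ((laguerreFun n k lam (w - z) : ℂ) * (laguerreFun n k lam (w - z') : ℂ)) =
      ((2 * Real.pi / |lam|) ^ n : ℝ) * (phase lam z z' * (laguerreFun n k lam (z' - z) : ℂ)) := by
  rw [← integral_add_left_eq_self _ z]
  have h : ∀ v, phase lam z (z + v) * (starRingEnd ℂ) (phase lam z' (z + v)) *
      ((laguerreFun n k lam (z + v - z) : ℂ) * (laguerreFun n k lam (z + v - z') : ℂ)) =
      phase lam z z' * (phase lam v (z' - z) * (laguerreFun n k lam (z' - z - v) : ℂ) *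
        (laguerreFun n k lam v : ℂ)) := by
    intro v
    rw [phase_mul_conj_phase_add, add_sub_cancel_left, laguerreFun_sub_comm n k lam (z + v) z',
      sub_sub]
    ring
  simp_rw [h, integral_const_mul, integral_laguerreFun_twist hn k hl]
  push_cast
  ring

/-- Expand the square as a double integral in (z, z') and integrate over w first; the reproducing
identity turns the two Laguerre factors into one. -/
lemma integral_normSq_twistedConv {n : ℕ} (hn : 1 ≤ n) (k : ℕ) {lam : ℝ} (hl : lam ≠ 0)
    {g : (Fin n → ℂ) → ℂ} (hgm : StronglyMeasurable g) (hg : Integrable g) :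
    Integrable (fun w => ‖twistedConv k lam g w‖ ^ 2) ∧
    ((∫ w, ‖twistedConv k lam g w‖ ^ 2 : ℝ) : ℂ) = ((2 * Real.pi / |lam|) ^ n : ℝ) *
      ∫ q, twistedKernel lam g q * (laguerreFun n k lam (q.2 - q.1) : ℂ) := by
  set Φ : (Fin n → ℂ) → (Fin n → ℂ) × (Fin n → ℂ) → ℂ := fun w q =>
    (g q.1 * phase lam q.1 w * (laguerreFun n k lam (w - q.1) : ℂ)) *
      (starRingEnd ℂ) (g q.2 * phase lam q.2 w * (laguerreFun n k lam (w - q.2) : ℂ)) with hΦ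
  set B : ℝ := 4 ^ k * (4 / 3) ^ n
  have hΦm : StronglyMeasurable (Function.uncurry Φ) := by
    have hm := hgm.measurable
    have h1 := measurable_phase_comp (n := n) (α := (Fin n → ℂ) × (Fin n → ℂ) × (Fin n → ℂ))
      (measurable_const (a := lam)) (measurable_snd.fst) measurable_fst
    have h2 := measurable_phase_comp (n := n) (α := (Fin n → ℂ) × (Fin n → ℂ) × (Fin n → ℂ))
      (measurable_const (a := lam)) (measurable_snd.snd) measurable_fst
    have h3 := measurable_laguerreFun_comp (n := n) (α := (Fin n → ℂ) × (Fin n → ℂ) × (Fin n → ℂ))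
      k (measurable_const (a := lam)) (measurable_fst.sub measurable_snd.fst)
    have h4 := measurable_laguerreFun_comp (n := n) (α := (Fin n → ℂ) × (Fin n → ℂ) × (Fin n → ℂ))
      k (measurable_const (a := lam)) (measurable_fst.sub measurable_snd.snd)
    have h5 : Measurable fun p : (Fin n → ℂ) × (Fin n → ℂ) × (Fin n → ℂ) => g p.2.1 :=
      hm.comp measurable_snd.fst
    have h6 : Measurable fun p : (Fin n → ℂ) × (Fin n → ℂ) × (Fin n → ℂ) => g p.2.2 :=
      hm.comp measurable_snd.snd
    exact (((h5.mul h1).mul h3).mul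
      (Complex.continuous_conj.measurable.comp ((h6.mul h2).mul h4))).stronglyMeasurable
  have hnorm : ∀ w q, ‖Φ w q‖ = (‖g q.1‖ * ‖g q.2‖) *
      (|laguerreFun n k lam (w - q.2)| * |laguerreFun n k lam (w - q.1)|) := by
    intro w q
    simp only [hΦ, norm_mul, norm_phase, Complex.norm_real, RCLike.norm_conj, Real.norm_eq_abs]
    ring
  have hφi := (integrable_laguerreFun hn k hl).abs
  have hbd : ∀ q : (Fin n → ℂ) × (Fin n → ℂ), Integrable fun w =>
      |laguerreFun n k lam (w - q.2)| * |laguerreFun n k lam (w - q.1)| := fun q =>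
    (hφi.comp_sub_right q.1).bdd_mul (c := B)
      ((continuous_laguerreFun n k lam).abs.comp (by fun_prop)).aestronglyMeasurable
      (Filter.Eventually.of_forall fun w => by
        rw [Real.norm_eq_abs, abs_abs]; exact abs_laguerreFun_le_const hn k lam _)
  -- One Laguerre factor is bounded by the constant `B` and the other is integrated in w, which
  -- leaves a multiple of |g(z)||g(z')|.
  have hΦi : Integrable (Function.uncurry Φ) (volume.prod volume) := by
    rw [integrable_prod_iff' hΦm.aestronglyMeasurable]
    constructor
    · refine Filter.Eventually.of_forall fun q => ?_
      refine ((hbd q).const_mul (‖g q.1‖ * ‖g q.2‖)).mono'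
        (hΦm.comp_measurable (measurable_prodMk_right)).aestronglyMeasurable
        (Filter.Eventually.of_forall fun w => (hnorm w q).le)
    · have hK : Integrable (fun q : (Fin n → ℂ) × (Fin n → ℂ) =>
          (‖g q.1‖ * ‖g q.2‖) * (B * ∫ w, |laguerreFun n k lam w|)) (volume.prod volume) :=
        (hg.norm.mul_prod hg.norm).mul_const _
      refine hK.mono' (hΦm.norm.integral_prod_left).aestronglyMeasurable
        (Filter.Eventually.of_forall fun q => ?_)
      rw [Real.norm_of_nonneg (integral_nonneg fun _ => norm_nonneg _)]
      simp only [Function.uncurry, hnorm]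
      rw [integral_const_mul]
      gcongr
      rw [← integral_sub_right_eq_self (fun w => |laguerreFun n k lam w|) q.1, ← integral_const_mul]
      refine integral_mono (hbd q) ((hφi.comp_sub_right q.1).const_mul B) fun w => ?_
      exact mul_le_mul_of_nonneg_right (abs_laguerreFun_le_const hn k lam _) (abs_nonneg _)
  have hsq : ∀ w, ((‖twistedConv k lam g w‖ ^ 2 : ℝ) : ℂ) = ∫ q, Φ w q := by
    intro w
    rw [Complex.ofReal_pow, ← Complex.mul_conj', twistedConv, ← integral_conj]
    exact (integral_prod_mul (fun z => g z * phase lam z w * (laguerreFun n k lam (w - z) : ℂ))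
      (fun z => (starRingEnd ℂ) (g z * phase lam z w * (laguerreFun n k lam (w - z) : ℂ)))).symm
  refine ⟨?_, ?_⟩
  · have := hΦi.integral_prod_left.re
    refine this.congr (Filter.Eventually.of_forall fun w => ?_)
    have h := congrArg Complex.re (hsq w)
    rw [Complex.ofReal_re] at h
    exact h.symm
  · rw [← integral_complex_ofReal]
    simp_rw [hsq]
    rw [integral_integral_swap hΦi, ← integral_const_mul]
    refine integral_congr_ae (Filter.Eventually.of_forall fun q => ?_)
    have h : ∀ w, Φ w q = (g q.1 * (starRingEnd ℂ) (g q.2)) *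
        (phase lam q.1 w * (starRingEnd ℂ) (phase lam q.2 w) *
        ((laguerreFun n k lam (w - q.1) : ℂ) * (laguerreFun n k lam (w - q.2) : ℂ))) := by
      intro w
      simp only [hΦ, map_mul, Complex.conj_ofReal]
      ring
    simp only [h]
    rw [integral_const_mul, integral_phase_mul_laguerreFun hn k hl, twistedKernel]
    ring

lemma hasSum_integral_twistedKernel {n : ℕ} (hn : 1 ≤ n) {lam : ℝ} (hl : lam ≠ 0)
    {g : (Fin n → ℂ) → ℂ} (hg : Integrable g) {r : ℝ} (hr : |r| < 1) :
    HasSum (fun k => (r : ℂ) ^ k *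
        ∫ q, twistedKernel lam g q * (laguerreFun n k lam (q.2 - q.1) : ℂ))
      (∫ q, twistedKernel lam g q * (laguerreGaussian n r lam (q.2 - q.1) : ℂ)) :=
  hasSum_integral_mul_laguerreFun hn (integrable_twistedKernel lam hg) (by fun_prop)
    (fun k z => abs_laguerreFun_le_inv_cst hn k hl z) hr (summable_abs_pow_mul_inv_cst n hr)

/-! ### Completeness of the Laguerre expansion of a twisted convolution -/

open Filter Topology in
lemma tendsto_eLpNorm_translate_sub {n : ℕ} {g : (Fin n → ℂ) → ℂ} (hg : MemLp g 2) :
    Tendsto (fun v => eLpNorm (fun w => g (w - v) - g w) 2 volume) (𝓝 0) (𝓝 0) := by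
  let T : C(Fin n → ℂ, C(Fin n → ℂ, Fin n → ℂ)) :=
    (ContinuousMap.mk (fun p : (Fin n → ℂ) × (Fin n → ℂ) => p.2 - p.1) (by fun_prop)).curry
  have hT : ∀ v, MeasurePreserving (T v) volume volume := fun v =>
    measurePreserving_sub_right volume v
  have h := Filter.Tendsto.compMeasurePreservingLp (E := ℂ) (p := 2) (l := 𝓝 (0 : Fin n → ℂ))
    (tendsto_const_nhds (x := hg.toLp g)) (T.continuous.tendsto 0) hT (hT 0) (by simp)
  simp only [Lp.toLp_compMeasurePreserving] at h
  rw [Lp.tendsto_Lp_iff_tendsto_eLpNorm''] at h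
  refine h.congr fun v => ?_
  congr 1
  funext w
  simp [T]

lemma norm_integral_mul_le_eLpNorm {α : Type*} [MeasurableSpace α] {μ : Measure α} {a b : α → ℂ}
    (ha : MemLp a 2 μ) (hb : MemLp b 2 μ) :
    ‖∫ x, a x * b x ∂μ‖ ≤ (eLpNorm a 2 μ * eLpNorm b 2 μ).toReal := by
  have h := eLpNorm_smul_le_mul_eLpNorm (p := 2) (q := 2) (r := 1) hb.1 ha.1
  refine (norm_integral_le_lintegral_norm _).trans
    (ENNReal.toReal_mono (ENNReal.mul_ne_top ha.2.ne hb.2.ne) ?_)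
  rw [eLpNorm_one_eq_lintegral_enorm] at h
  simpa using h

/-- The twisted autocorrelation of `g`. -/
def twistedCorr {n : ℕ} (lam : ℝ) (g : (Fin n → ℂ) → ℂ) (v : Fin n → ℂ) : ℂ :=
  ∫ w, twistedKernel lam g (w - v, w)

lemma measurable_twistedKernel {n : ℕ} (lam : ℝ) {g : (Fin n → ℂ) → ℂ} (hg : Measurable g) :
    Measurable (twistedKernel lam g) := by
  have h1 := measurable_phase_comp (n := n) (α := (Fin n → ℂ) × (Fin n → ℂ))
      (measurable_const (a := lam)) measurable_fst measurable_snd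
  exact ((hg.comp measurable_fst).mul
    (Complex.continuous_conj.measurable.comp (hg.comp measurable_snd))).mul h1

lemma norm_twistedKernel {n : ℕ} (lam : ℝ) (g : (Fin n → ℂ) → ℂ) (q) :
    ‖twistedKernel lam g q‖ = ‖g q.1‖ * ‖g q.2‖ := by
  simp [twistedKernel, norm_phase]

lemma norm_twistedCorr_le {n : ℕ} (lam : ℝ) {g : (Fin n → ℂ) → ℂ} (hg : MemLp g 2)
    (v : Fin n → ℂ) : ‖twistedCorr lam g v‖ ≤ ∫ w, ‖g w‖ ^ 2 := by
  have hi : Integrable fun w => ‖g w‖ ^ 2 := hg.integrable_norm_pow (by norm_num)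
  have hi2 := hi.comp_sub_right v
  calc _ ≤ ∫ w, (1 / 2) * (‖g w‖ ^ 2 + ‖g (w - v)‖ ^ 2) := by
        refine norm_integral_le_of_norm_le ((hi.add hi2).const_mul _)
          (Filter.Eventually.of_forall fun w => ?_)
        rw [norm_twistedKernel]
        nlinarith [sq_nonneg (‖g w‖ - ‖g (w - v)‖)]
    _ = _ := by
        rw [integral_const_mul, integral_add hi hi2,
          integral_sub_right_eq_self (fun w => ‖g w‖ ^ 2) v]
        ring

-- Replace g(w - v) by g(w): the error vanishes by L² continuity of translation, and in the rest the
-- phase tends to 1 because Im (w · w̄) = 0.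
open Filter Topology in
lemma tendsto_twistedCorr {n : ℕ} (lam : ℝ) {g : (Fin n → ℂ) → ℂ} (hg : MemLp g 2) :
    Tendsto (twistedCorr lam g) (𝓝 0) (𝓝 ((∫ w, ‖g w‖ ^ 2 : ℝ) : ℂ)) := by
  have hph : ∀ v, Continuous fun w => phase lam (w - v) w := fun v =>
    (continuous_phase_fixed lam).comp (f := fun w : Fin n → ℂ => (w - v, w)) (by fun_prop)
  set b : (Fin n → ℂ) → (Fin n → ℂ) → ℂ := fun v w => (starRingEnd ℂ) (g w) * phase lam (w - v) w
  have hbm : ∀ v, AEStronglyMeasurable (b v) volume := fun v =>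
    (Complex.continuous_conj.comp_aestronglyMeasurable hg.1).mul (hph v).aestronglyMeasurable
  have hb : ∀ v, MemLp (b v) 2 := fun v => hg.congr_norm (hbm v)
    (Eventually.of_forall fun w => by simp [b, norm_phase])
  have hbn : ∀ v, eLpNorm (b v) 2 volume = eLpNorm g 2 volume := fun v =>
    eLpNorm_congr_norm_ae (Eventually.of_forall fun w => by simp [b, norm_phase])
  have hgv : ∀ v, MemLp (fun w => g (w - v)) 2 := fun v =>
    hg.comp_measurePreserving (measurePreserving_sub_right volume v)
  have hsplit : ∀ v, twistedCorr lam g v =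
      (∫ w, (g (w - v) - g w) * b v w) + ∫ w, g w * b v w := by
    intro v
    have hi1 : Integrable fun w => (g (w - v) - g w) * b v w :=
      ((hgv v).sub hg).integrable_mul (hb v)
    have hi2 : Integrable fun w => g w * b v w := hg.integrable_mul (hb v)
    rw [← integral_add hi1 hi2]
    refine integral_congr_ae (Eventually.of_forall fun w => ?_)
    simp only [twistedKernel, b]
    ring
  have h1 : Tendsto (fun v => ∫ w, (g (w - v) - g w) * b v w) (𝓝 0) (𝓝 0) := by
    refine squeeze_zero_norm (fun v => norm_integral_mul_le_eLpNorm ((hgv v).sub hg) (hb v)) ?_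
    simp_rw [hbn]
    have h2 := ENNReal.Tendsto.mul_const (tendsto_eLpNorm_translate_sub hg)
      (Or.inr hg.2.ne) (b := eLpNorm g 2 volume)
    rw [zero_mul] at h2
    exact (ENNReal.tendsto_toReal (by simp)).comp h2
  have h2 : Tendsto (fun v => ∫ w, g w * b v w) (𝓝 0) (𝓝 (∫ w, ((‖g w‖ ^ 2 : ℝ) : ℂ))) := by
    refine tendsto_integral_filter_of_dominated_convergence (fun w => ‖g w‖ ^ 2)
      (Eventually.of_forall fun v => hg.1.mul (hbm v)) ?_
      (hg.integrable_norm_pow (by norm_num)) ?_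
    · refine Eventually.of_forall fun v => Eventually.of_forall fun w => ?_
      simp [b, norm_phase, sq]
    · refine Eventually.of_forall fun w => ?_
      have hc : Continuous fun v => g w * ((starRingEnd ℂ) (g w) * phase lam (w - v) w) := by
        refine continuous_const.mul (continuous_const.mul ?_)
        exact (continuous_phase_fixed lam).comp (f := fun v : Fin n → ℂ => (w - v, w)) (by fun_prop)
      have h3 := hc.tendsto 0
      have h4 : g w * ((starRingEnd ℂ) (g w) * phase lam (w - 0) w) = ((‖g w‖ ^ 2 : ℝ) : ℂ) := by
        rw [sub_zero, phase, symp_self, ← mul_assoc, Complex.mul_conj']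
        simp
      rw [h4] at h3
      exact h3
  rw [integral_complex_ofReal] at h2
  have h3 := h1.add h2
  rw [zero_add] at h3
  exact h3.congr fun v => (hsplit v).symm

/-- The measure-preserving shear (w, v) ↦ (w - v, w) makes v the difference variable, so integrating
out w leaves the autocorrelation. -/
lemma integral_twistedKernel_mul {n : ℕ} (lam : ℝ) {g : (Fin n → ℂ) → ℂ}
    (hgm : StronglyMeasurable g) (hg : Integrable g) {G : (Fin n → ℂ) → ℝ} (hG : Continuous G)
    {B : ℝ} (hB : ∀ v, |G v| ≤ B) :
    ∫ q, twistedKernel lam g q * (G (q.2 - q.1) : ℂ) = ∫ v, (G v : ℂ) * twistedCorr lam g v := by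
  set f : (Fin n → ℂ) × (Fin n → ℂ) → ℂ := fun q => twistedKernel lam g q * (G (q.2 - q.1) : ℂ)
    with hf
  have hGc : Continuous fun q : (Fin n → ℂ) × (Fin n → ℂ) => (G (q.2 - q.1) : ℂ) :=
    Complex.continuous_ofReal.comp (hG.comp (by fun_prop))
  have hfm : StronglyMeasurable f :=
    ((measurable_twistedKernel lam hgm.measurable).mul hGc.measurable).stronglyMeasurable
  have hfi : Integrable f (volume.prod volume) :=
    (integrable_twistedKernel lam hg).mul_bdd (c := B) hGc.aestronglyMeasurable
      (Filter.Eventually.of_forall fun q => by rw [Complex.norm_real]; exact hB _)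
  have hS : MeasurePreserving (fun p : (Fin n → ℂ) × (Fin n → ℂ) => (p.1, p.1 - p.2))
      (volume.prod volume) (volume.prod volume) :=
    (MeasurePreserving.id volume).skew_product (g := fun w v => w - v) (by fun_prop)
      (Filter.Eventually.of_forall fun w => (Measure.measurePreserving_sub_left volume w).map_eq)
  have hT : MeasurePreserving (fun p : (Fin n → ℂ) × (Fin n → ℂ) => (p.1 - p.2, p.1))
      (volume.prod volume) (volume.prod volume) := Measure.measurePreserving_swap.comp hS
  have h1 : ∫ q, f q =
      ∫ p : (Fin n → ℂ) × (Fin n → ℂ), f (p.1 - p.2, p.1) ∂(volume.prod volume) := by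
    rw [Measure.volume_eq_prod]
    conv_lhs => rw [← hT.map_eq]
    exact integral_map hT.measurable.aemeasurable hfm.aestronglyMeasurable
  have h2 : Integrable (fun p : (Fin n → ℂ) × (Fin n → ℂ) => f (p.1 - p.2, p.1))
      (volume.prod volume) := hT.integrable_comp_of_integrable hfi
  rw [h1, integral_prod_symm _ h2]
  refine integral_congr_ae (Filter.Eventually.of_forall fun v => ?_)
  simp only [hf, twistedCorr, sub_sub_cancel]
  rw [integral_mul_const, mul_comm]

/-- Dilation by √(1-r) in real dimension 2n has Jacobian (1-r)ⁿ, exactly cancelling the prefactor.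
This exhibits the Gaussian as an approximate identity up to a constant as r → 1. -/
lemma integral_laguerreGaussian_mul {n : ℕ} {r : ℝ} (hr : |r| < 1) (lam : ℝ)
    (H : (Fin n → ℂ) → ℂ) :
    ∫ v, (laguerreGaussian n r lam v : ℂ) * H v =
      ∫ v, (Real.exp (-(|lam| / 4 * (1 + r) * normSq v)) : ℂ) * H (Real.sqrt (1 - r) • v) := by
  have hr1 : 0 < 1 - r := by have := (abs_lt.1 hr).2; linarith
  have hR : 0 < Real.sqrt (1 - r) := Real.sqrt_pos.2 hr1
  have h := Measure.integral_comp_smul volume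
    (fun v : Fin n → ℂ => (laguerreGaussian n r lam v : ℂ) * H v) (Real.sqrt (1 - r))
  have hd : Module.finrank ℝ (Fin n → ℂ) = 2 * n := by
    rw [Module.finrank_pi_fintype]; simp [Complex.finrank_real_complex, mul_comm]
  rw [hd, pow_mul, Real.sq_sqrt hr1.le, abs_of_pos (by positivity)] at h
  have h2 : ∀ v, (laguerreGaussian n r lam (Real.sqrt (1 - r) • v) : ℂ) *
      H (Real.sqrt (1 - r) • v) =
      (((1 - r) ^ n)⁻¹ : ℝ) • ((Real.exp (-(|lam| / 4 * (1 + r) * normSq v)) : ℂ) *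
        H (Real.sqrt (1 - r) • v)) := by
    intro v
    have h3 : |lam| / 4 * ((1 + r) / (1 - r)) * ((1 - r) * normSq v) =
        |lam| / 4 * (1 + r) * normSq v := by field_simp
    rw [laguerreGaussian, normSq_smul, Real.sq_sqrt hr1.le, Complex.real_smul, h3,
      Complex.ofReal_mul, mul_assoc]
  simp_rw [h2, integral_smul] at h
  exact (smul_right_injective ℂ (by positivity : ((1 - r) ^ n)⁻¹ ≠ 0) h).symm

-- After dilation the Gaussian rate tends to |λ|/2, giving mass (2π/|λ|)ⁿ, while the bounded
-- autocorrelation tends to its value ‖g‖² at 0.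
open Filter Topology in
lemma tendsto_integral_twistedKernel {n : ℕ} {lam : ℝ} (hl : lam ≠ 0)
    {g : (Fin n → ℂ) → ℂ} (hgm : StronglyMeasurable g) (hg : Integrable g) (hg2 : MemLp g 2) :
    Tendsto (fun r : ℝ => ∫ q, twistedKernel lam g q * (laguerreGaussian n r lam (q.2 - q.1) : ℂ))
      (𝓝[<] 1) (𝓝 (((2 * Real.pi / |lam|) ^ n * ∫ w, ‖g w‖ ^ 2 : ℝ) : ℂ)) := by
  have hHm : Measurable (twistedCorr lam g) := by
    have h : Measurable fun p : (Fin n → ℂ) × (Fin n → ℂ) => twistedKernel lam g (p.2 - p.1, p.2) :=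
      (measurable_twistedKernel lam hgm.measurable).comp (by fun_prop)
    exact (h.stronglyMeasurable.integral_prod_right').measurable
  have ha : 0 < |lam| := abs_pos.2 hl
  have hIoo : ∀ᶠ r : ℝ in 𝓝[<] 1, r ∈ Set.Ioo (0 : ℝ) 1 := Ioo_mem_nhdsLT (by norm_num)
  have hlim : Tendsto (fun r : ℝ => ∫ v,
      (Real.exp (-(|lam| / 4 * (1 + r) * normSq v)) : ℂ) *
        twistedCorr lam g (Real.sqrt (1 - r) • v))
      (𝓝[<] 1) (𝓝 (∫ v : Fin n → ℂ, (Real.exp (-(|lam| / 2 * normSq v)) : ℂ) *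
        ((∫ w, ‖g w‖ ^ 2 : ℝ) : ℂ))) := by
    refine tendsto_integral_filter_of_dominated_convergence
      (fun v => Real.exp (-(|lam| / 4 * normSq v)) * ∫ w, ‖g w‖ ^ 2) ?_ ?_ ?_ ?_
    · refine Eventually.of_forall fun r => ?_
      have h1 : Continuous fun v : Fin n → ℂ =>
          (Real.exp (-(|lam| / 4 * (1 + r) * normSq v)) : ℂ) := by
        have := continuous_normSq (n := n)
        fun_prop
      exact (h1.measurable.mul (hHm.comp (by fun_prop))).aestronglyMeasurable
    · filter_upwards [hIoo] with r hr
      refine Eventually.of_forall fun v => ?_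
      rw [norm_mul, Complex.norm_real, Real.norm_of_nonneg (Real.exp_pos _).le]
      refine mul_le_mul (Real.exp_le_exp.2 ?_) (norm_twistedCorr_le lam hg2 _) (norm_nonneg _)
        (Real.exp_pos _).le
      have h2 := normSq_nonneg v
      have : 0 ≤ |lam| / 4 * normSq v * r := mul_nonneg (by positivity) hr.1.le
      nlinarith
    · exact (integrable_exp_neg_mul_normSq (by positivity)).mul_const _
    · refine Eventually.of_forall fun v => ?_
      refine Tendsto.mul ?_ ((tendsto_twistedCorr lam hg2).comp ?_)
      · have h1 : Continuous fun r : ℝ => (Real.exp (-(|lam| / 4 * (1 + r) * normSq v)) : ℂ) := by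
          fun_prop
        have h2 := h1.tendsto 1
        rw [show |lam| / 4 * (1 + 1) = |lam| / 2 by ring] at h2
        exact h2.mono_left nhdsWithin_le_nhds
      · have h1 : Continuous fun r : ℝ => Real.sqrt (1 - r) • v := by fun_prop
        have h2 := h1.tendsto 1
        rw [sub_self, Real.sqrt_zero, zero_smul] at h2
        exact h2.mono_left nhdsWithin_le_nhds
  rw [integral_mul_const, integral_complex_ofReal, integral_exp_neg_mul_normSq (by positivity),
    ← Complex.ofReal_mul, show Real.pi / (|lam| / 2) = 2 * Real.pi / |lam| by field_simp] at hlim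
  refine hlim.congr' ?_
  filter_upwards [hIoo] with r hr
  have hr' : |r| < 1 := abs_lt.2 ⟨by linarith [hr.1], hr.2⟩
  have hr1 : 0 < 1 - r := by linarith [hr.2]
  rw [← integral_laguerreGaussian_mul hr', integral_twistedKernel_mul lam hgm hg
    (continuous_laguerreGaussian n r lam) (B := ((1 - r) ^ n)⁻¹)]
  intro v
  rw [abs_of_nonneg (laguerreGaussian_nonneg hr' lam v), laguerreGaussian]
  refine mul_le_of_le_one_right (by positivity) (Real.exp_le_one_iff.2 ?_)
  have := (gaussian_rate_pos hr' hl).le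
  have := normSq_nonneg v
  rw [neg_nonpos]; positivity

-- For nonnegative coefficients Abel summability implies summability: finite partial sums pass to
-- the limit r → 1, and rᵏ ≤ 1 gives the other inequality.
open Filter Topology in
lemma tsum_ofReal_eq_of_tendsto_abel {b : ℕ → ℝ} (hb : ∀ k, 0 ≤ b k) {L : ℝ} {F : ℝ → ℝ}
    (hF : ∀ r ∈ Set.Ioo (0 : ℝ) 1, HasSum (fun k => r ^ k * b k) (F r))
    (hL : Tendsto F (𝓝[<] 1) (𝓝 L)) :
    ∑' k, ENNReal.ofReal (b k) = ENNReal.ofReal L := by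
  have hIoo : ∀ᶠ r : ℝ in 𝓝[<] 1, r ∈ Set.Ioo (0 : ℝ) 1 := Ioo_mem_nhdsLT (by norm_num)
  have hFr : ∀ r ∈ Set.Ioo (0 : ℝ) 1,
      ∑' k, ENNReal.ofReal (r ^ k * b k) = ENNReal.ofReal (F r) := by
    intro r hr
    rw [← (hF r hr).tsum_eq, ENNReal.ofReal_tsum_of_nonneg
      (fun k => mul_nonneg (pow_nonneg hr.1.le _) (hb k)) (hF r hr).summable]
  have hL' := (ENNReal.continuous_ofReal.tendsto L).comp hL
  refine le_antisymm ?_ ?_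
  · refine ENNReal.summable.tsum_le_of_sum_le fun s => ?_
    have h1 : Continuous fun r : ℝ => ∑ k ∈ s, ENNReal.ofReal (r ^ k * b k) :=
      continuous_finsetSum _ fun k _ => ENNReal.continuous_ofReal.comp (by fun_prop)
    have h2 := (h1.tendsto 1).mono_left (nhdsWithin_le_nhds (s := Set.Iio 1))
    simp only [one_pow, one_mul] at h2
    refine le_of_tendsto_of_tendsto h2 hL' ?_
    filter_upwards [hIoo] with r hr
    rw [Function.comp, ← hFr r hr]
    exact ENNReal.sum_le_tsum s
  · refine le_of_tendsto hL' ?_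
    filter_upwards [hIoo] with r hr
    rw [Function.comp, ← hFr r hr]
    refine ENNReal.tsum_le_tsum fun k => ENNReal.ofReal_le_ofReal ?_
    exact mul_le_of_le_one_left (hb k) (pow_le_one₀ hr.1.le hr.2.le)

/-- The exponent 2n collects one factor (2π/|λ|)ⁿ from the reproducing identity and one from the
limiting mass of the Gaussian. -/
lemma tsum_lintegral_twistedConv {n : ℕ} (hn : 1 ≤ n) {lam : ℝ} (hl : lam ≠ 0)
    {g : (Fin n → ℂ) → ℂ} (hgm : StronglyMeasurable g) (hg : Integrable g) (hg2 : MemLp g 2) :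
    ∑' k, ∫⁻ w, ‖twistedConv k lam g w‖ₑ ^ 2 =
      ENNReal.ofReal ((2 * Real.pi / |lam|) ^ (2 * n)) * ∫⁻ w, ‖g w‖ₑ ^ 2 := by
  set C : ℝ := (2 * Real.pi / |lam|) ^ n with hC
  have hC0 : 0 < C := by have := Real.pi_pos; have := abs_pos.2 hl; positivity
  have hkey := fun k => integral_normSq_twistedConv hn k hl hgm hg
  have hlint : ∀ k, ∫⁻ w, ‖twistedConv k lam g w‖ₑ ^ 2 =
      ENNReal.ofReal (∫ w, ‖twistedConv k lam g w‖ ^ 2) := by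
    intro k
    rw [ofReal_integral_eq_lintegral_ofReal (hkey k).1
      (Filter.Eventually.of_forall fun w => by positivity)]
    simp [ENNReal.ofReal_pow]
  have hlint2 : ∫⁻ w, ‖g w‖ₑ ^ 2 = ENNReal.ofReal (∫ w, ‖g w‖ ^ 2) := by
    rw [ofReal_integral_eq_lintegral_ofReal (hg2.integrable_norm_pow (by norm_num))
      (Filter.Eventually.of_forall fun w => by positivity)]
    simp [ENNReal.ofReal_pow]
  simp_rw [hlint]
  rw [hlint2, ← ENNReal.ofReal_mul (by positivity), mul_comm 2 n, pow_mul, ← hC]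
  refine tsum_ofReal_eq_of_tendsto_abel (fun k => integral_nonneg fun w => by positivity)
    (F := fun r => C * (∫ q, twistedKernel lam g q * (laguerreGaussian n r lam (q.2 - q.1) : ℂ)).re)
    ?_ ?_
  · intro r hr
    have h := (hasSum_integral_twistedKernel hn hl hg
      (abs_lt.2 ⟨by linarith [hr.1], hr.2⟩)).mul_left (C : ℂ)
    have h2 := Complex.hasSum_re h
    rw [Complex.re_ofReal_mul] at h2
    convert! h2 using 2 with k
    rw [mul_left_comm, ← (hkey k).2, ← Complex.ofReal_pow, ← Complex.ofReal_mul, Complex.ofReal_re]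
  · have h := ((Complex.continuous_re.tendsto _).comp
      (tendsto_integral_twistedKernel hl hgm hg hg2)).const_mul C
    rw [Complex.ofReal_re, ← hC, ← mul_assoc, ← sq] at h
    exact h

/-! ### Plancherel's theorem on the line for integrable square-integrable functions -/

-- The L² transform and the Fourier integral are tested against smooth compactly supported
-- functions; in both cases the transform moves onto the test function.
open FourierTransform SchwartzMap in
lemma coeFn_fourier_toLp_ae_eq {f : ℝ → ℂ} (hf : Integrable f) (hf2 : MemLp f 2) :
    ((𝓕 (hf2.toLp f) : Lp ℂ 2 (volume : Measure ℝ)) : ℝ → ℂ) =ᵐ[volume] 𝓕 f := by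
  have hcont : Continuous (𝓕 f) :=
    VectorFourier.fourierIntegral_continuous Real.continuous_fourierChar
      (by exact continuous_inner) hf
  refine ae_eq_of_integral_contDiff_smul_eq
    ((Lp.memLp _).locallyIntegrable (by norm_num)) hcont.locallyIntegrable ?_
  intro g hg hgs
  have hgs' : HasCompactSupport (Complex.ofRealCLM ∘ g) := hgs.comp_left rfl
  set φ : 𝓢(ℝ, ℂ) := hgs'.toSchwartzMap (Complex.ofRealCLM.contDiff.comp hg) with hφ
  have hφx : ∀ x, φ x = (g x : ℂ) := fun x => rfl
  have h1 := congrArg (fun T => T φ) (Lp.fourier_toTemperedDistribution_eq (hf2.toLp f))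
  simp only [TemperedDistribution.fourier_apply, Lp.toTemperedDistribution_apply] at h1
  have h2 : ∫ x, (𝓕 φ) x • (hf2.toLp f) x = ∫ x, (𝓕 φ) x • f x := by
    refine integral_congr_ae ?_
    filter_upwards [hf2.coeFn_toLp] with x hx
    rw [hx]
  have h3 : ∫ ξ, (𝓕 (φ : ℝ → ℂ)) ξ • f ξ = ∫ x, φ x • (𝓕 f) x := by
    have := VectorFourier.integral_fourierIntegral_smul_eq_flip (L := innerₗ ℝ)
      (μ := volume) (ν := volume)
      Real.continuous_fourierChar (by exact continuous_inner) (φ.integrable (μ := volume)) hf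
    rw [flip_innerₗ] at this
    exact this
  rw [h2] at h1
  simp only [Complex.real_smul]
  calc _ = ∫ x, φ x • (𝓕 (hf2.toLp f) : Lp ℂ 2 (volume : Measure ℝ)) x := rfl
    _ = ∫ x, (𝓕 φ) x • f x := h1.symm
    _ = _ := h3

open FourierTransform in
lemma lintegral_enorm_sq_fourier {f : ℝ → ℂ} (hf : Integrable f) (hf2 : MemLp f 2) :
    ∫⁻ ξ, ‖𝓕 f ξ‖ₑ ^ 2 = ∫⁻ x, ‖f x‖ₑ ^ 2 := by
  have h := Lp.norm_fourier_eq (hf2.toLp f)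
  rw [Lp.norm_def, Lp.norm_def, ENNReal.toReal_eq_toReal_iff' (Lp.eLpNorm_ne_top _)
    (Lp.eLpNorm_ne_top _), eLpNorm_congr_ae (coeFn_fourier_toLp_ae_eq hf hf2),
    eLpNorm_congr_ae hf2.coeFn_toLp] at h
  have h2 := congrArg (fun x => x ^ 2) h
  have key : ∀ u : ℝ → ℂ, eLpNorm u 2 volume ^ 2 = ∫⁻ x, ‖u x‖ₑ ^ 2 := fun u => by
    simpa using eLpNorm_nnreal_pow_eq_lintegral (f := u) (μ := (volume : Measure ℝ))
      (p := 2) (by norm_num)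
  rwa [key, key] at h2

open FourierTransform in
lemma lintegral_enorm_sq_integral_exp {f : ℝ → ℂ} (hf : Integrable f) (hf2 : MemLp f 2) :
    ∫⁻ lam : ℝ, ‖∫ t, f t * Complex.exp (((-(lam * t) : ℝ) : ℂ) * Complex.I)‖ₑ ^ 2 =
      ENNReal.ofReal (2 * Real.pi) * ∫⁻ x, ‖f x‖ₑ ^ 2 := by
  have hpi := Real.pi_pos
  rw [← lintegral_enorm_sq_fourier hf hf2]
  have h0 : 2 * Real.pi ≠ 0 := by positivity
  -- Substituting λ = 2πξ passes from the kernel e^{-2πiξt} to e^{-iλt} and produces the factor 2π.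
  have key : ∀ Q : ℝ → ENNReal,
      ∫⁻ x, Q x = ENNReal.ofReal (2 * Real.pi) * ∫⁻ x, Q (2 * Real.pi * x) := by
    intro Q
    have hemb : MeasurableEmbedding fun x : ℝ => 2 * Real.pi * x := measurableEmbedding_mulLeft₀ h0
    conv_lhs => rw [← Real.smul_map_volume_mul_left h0]
    rw [lintegral_smul_measure, hemb.lintegral_map, abs_of_pos (by positivity), smul_eq_mul]
  rw [key]
  congr 1
  refine lintegral_congr fun ξ => ?_
  rw [Real.fourier_real_eq_integral_exp_smul]
  congr 3
  funext t
  rw [smul_eq_mul, mul_comm]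
  congr 4
  ring

/-! ### The Strichartz transform is isometric on `L¹ ∩ L²` -/

/-- The Fourier transform in the central variable. -/
def centralFourier {n : ℕ} (u : Heis n → ℂ) (lam : ℝ) (z : Fin n → ℂ) : ℂ :=
  ∫ t, u (z, t) * Complex.exp (((-(lam * t) : ℝ) : ℂ) * Complex.I)

lemma eigenFun_inv_mul {n : ℕ} (k : ℕ) (lam : ℝ) (z w : Fin n → ℂ) (t : ℝ) :
    eigenFun n k lam (mul (inv (z, t)) (w, 0)) =
      Complex.exp (((-(lam * t) : ℝ) : ℂ) * Complex.I) * phase lam z w *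
        (laguerreFun n k lam (w - z) : ℂ) := by
  have h : (∑ j, (-z) j * (starRingEnd ℂ) (w j)).im = -symp z w := symp_neg_left z w
  simp only [eigenFun, mul, inv]
  rw [h, phase, ← Complex.exp_add, neg_add_eq_sub z w]
  congr 2
  push_cast
  ring

lemma continuous_eigenFun_inv_mul {n : ℕ} (k : ℕ) (lam : ℝ) (w : Fin n → ℂ) :
    Continuous fun p : Heis n => eigenFun n k lam (mul (inv p) (w, 0)) := by
  have h1 : Continuous fun p : Heis n => phase lam p.1 w :=
    (continuous_phase_fixed lam).comp (f := fun p : Heis n => (p.1, w)) (by fun_prop)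
  have h2 : Continuous fun p : Heis n => (laguerreFun n k lam (w - p.1) : ℂ) :=
    Complex.continuous_ofReal.comp ((continuous_laguerreFun n k lam).comp (by fun_prop))
  have h3 : Continuous fun p : Heis n => Complex.exp (((-(lam * p.2) : ℝ) : ℂ) * Complex.I) := by
    fun_prop
  exact ((h3.mul h1).mul h2).congr fun p => (eigenFun_inv_mul k lam p.1 w p.2).symm

lemma norm_eigenFun_inv_mul {n : ℕ} (k : ℕ) (lam : ℝ) (w : Fin n → ℂ) (p : Heis n) :
    ‖eigenFun n k lam (mul (inv p) (w, 0))‖ = |laguerreFun n k lam (w - p.1)| := by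
  rw [show p = (p.1, p.2) from rfl, eigenFun_inv_mul, norm_mul, norm_mul, norm_phase,
    Complex.norm_exp_ofReal_mul_I, one_mul, one_mul, Complex.norm_real, Real.norm_eq_abs]

lemma integrable_mul_eigenFun {n : ℕ} (hn : 1 ≤ n) (k : ℕ) (lam : ℝ) {u : Heis n → ℂ}
    (hu : Integrable u) (w : Fin n → ℂ) :
    Integrable fun p => u p * eigenFun n k lam (mul (inv p) (w, 0)) :=
  hu.mul_bdd (c := 4 ^ k * (4 / 3) ^ n) (continuous_eigenFun_inv_mul k lam w).aestronglyMeasurable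
    (Filter.Eventually.of_forall fun p => by
      rw [norm_eigenFun_inv_mul]; exact abs_laguerreFun_le_const hn k lam _)

lemma strichartz_fanPoint {n : ℕ} (k : ℕ) {lam : ℝ} (hl : lam ≠ 0) (u : Heis n → ℂ)
    (w : Fin n → ℂ) :
    strichartz u (fanPoint n k lam, w) =
      (cst n k : ℂ) * ∫ p : Heis n, u p * eigenFun n k lam (mul (inv p) (w, 0)) := by
  have h : (fanPoint n k lam).1.1 = lam := rfl
  rw [strichartz, if_pos (by simpa [h] using hl)]
  simp only [fanIndex_fanPoint n k hl, h]

lemma strichartz_fanPoint_eq_twistedConv {n : ℕ} (hn : 1 ≤ n) (k : ℕ) {lam : ℝ} (hl : lam ≠ 0)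
    {u : Heis n → ℂ} (hu : Integrable u) (w : Fin n → ℂ) :
    strichartz u (fanPoint n k lam, w) =
      (cst n k : ℂ) * twistedConv k lam (centralFourier u lam) w := by
  have hi := integrable_mul_eigenFun hn k lam hu w
  rw [Measure.volume_eq_prod] at hi
  rw [strichartz_fanPoint k hl, Measure.volume_eq_prod, integral_prod _ hi, twistedConv]
  congr 2
  funext z
  rw [centralFourier, mul_assoc, ← integral_mul_const]
  refine integral_congr_ae (Filter.Eventually.of_forall fun t => ?_)
  simp only [eigenFun_inv_mul]
  ring

lemma stronglyMeasurable_centralFourier {n : ℕ} {u : Heis n → ℂ} (hu : StronglyMeasurable u) :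
    StronglyMeasurable fun p : ℝ × (Fin n → ℂ) => centralFourier u p.1 p.2 := by
  have h1 : Measurable fun q : (ℝ × (Fin n → ℂ)) × ℝ => u (q.1.2, q.2) :=
    hu.measurable.comp (by fun_prop)
  have h2 : Measurable fun q : (ℝ × (Fin n → ℂ)) × ℝ =>
      Complex.exp (((-(q.1.1 * q.2) : ℝ) : ℂ) * Complex.I) := by fun_prop
  exact (h1.mul h2).stronglyMeasurable.integral_prod_right'

lemma stronglyMeasurable_twistedConv {n : ℕ} (k : ℕ) {g : ℝ → (Fin n → ℂ) → ℂ}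
    (hg : StronglyMeasurable fun p : ℝ × (Fin n → ℂ) => g p.1 p.2) :
    StronglyMeasurable fun p : ℝ × (Fin n → ℂ) => twistedConv k p.1 (g p.1) p.2 := by
  have h1 : Measurable fun q : (ℝ × (Fin n → ℂ)) × (Fin n → ℂ) => g q.1.1 q.2 :=
    hg.measurable.comp (f := fun q : (ℝ × (Fin n → ℂ)) × (Fin n → ℂ) => (q.1.1, q.2)) (by fun_prop)
  have h2 := measurable_phase_comp (n := n) (α := (ℝ × (Fin n → ℂ)) × (Fin n → ℂ))
    measurable_fst.fst measurable_snd measurable_fst.snd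
  have h3 := measurable_laguerreFun_comp (n := n) (α := (ℝ × (Fin n → ℂ)) × (Fin n → ℂ))
    k measurable_fst.fst (measurable_fst.snd.sub measurable_snd)
  exact ((h1.mul h2).mul h3).stronglyMeasurable.integral_prod_right'

lemma integrable_centralFourier {n : ℕ} {u : Heis n → ℂ} (hu : Integrable u) (lam : ℝ) :
    Integrable (centralFourier u lam) := by
  have h1 : Continuous fun p : Heis n => Complex.exp (((-(lam * p.2) : ℝ) : ℂ) * Complex.I) := by
    fun_prop
  have h := hu.mul_bdd (c := 1) h1.aestronglyMeasurable
    (Filter.Eventually.of_forall fun p => (Complex.norm_exp_ofReal_mul_I _).le)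
  rw [Measure.volume_eq_prod] at h
  exact h.integral_prod_left

lemma lintegral_enorm_sq_centralFourier {n : ℕ} {u : Heis n → ℂ} (hum : StronglyMeasurable u)
    (hu : Integrable u) (hu2 : MemLp u 2) :
    ∫⁻ lam : ℝ, ∫⁻ z, ‖centralFourier u lam z‖ₑ ^ 2 =
      ENNReal.ofReal (2 * Real.pi) * ∫⁻ p, ‖u p‖ₑ ^ 2 := by
  have hm : Measurable fun p : ℝ × (Fin n → ℂ) => ‖centralFourier u p.1 p.2‖ₑ ^ 2 :=
    (stronglyMeasurable_centralFourier hum).measurable.enorm.pow_const 2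
  have hum2 : Measurable fun p => ‖u p‖ₑ ^ 2 := hum.measurable.enorm.pow_const 2
  rw [lintegral_lintegral_swap hm.aemeasurable, Measure.volume_eq_prod,
    lintegral_prod _ hum2.aemeasurable, ← lintegral_const_mul _ hum2.lintegral_prod_right']
  have hi2 : Integrable fun p => ‖u p‖ ^ 2 := hu2.integrable_norm_pow (by norm_num)
  rw [Measure.volume_eq_prod] at hu hi2
  refine lintegral_congr_ae ?_
  filter_upwards [hu.prod_right_ae, hi2.prod_right_ae] with z h1 h2
  refine lintegral_enorm_sq_integral_exp h1 ((memLp_two_iff_integrable_sq_norm h1.1).2 h2)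

lemma measurable_fanPoint (n k : ℕ) : Measurable (fanPoint n k) := by
  refine Measurable.subtype_mk ?_
  fun_prop

/-- The first coordinate is a measurable left inverse. Being an embedding lets integrals and
measurability be checked ray by ray for functions not known to be measurable on the whole fan, such
as `strichartz u`. -/
lemma measurableEmbedding_fanPoint (n k : ℕ) : MeasurableEmbedding (fanPoint n k) := by
  have hr : Set.range (fanPoint n k) = {a : fan n | a.1.2 = (2 * k + n) * |a.1.1|} := by
    ext a
    constructor
    · rintro ⟨lam, rfl⟩
      rfl
    · intro h
      exact ⟨a.1.1, Subtype.ext (Prod.ext rfl h.symm)⟩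
  refine MeasurableEmbedding.of_measurable_inverse (g := fun a => a.1.1) (measurable_fanPoint n k)
    ?_ (by fun_prop) (fun lam => rfl)
  rw [hr]
  exact measurableSet_eq_fun (by fun_prop) (by fun_prop)

/-- The density of `ν₂` on the ray `R_k`. -/
def fanDensity (n k : ℕ) (lam : ℝ) : ENNReal :=
  ENNReal.ofReal (((2 * Real.pi) ^ (2 * n + 1))⁻¹ * (cst n k ^ 2)⁻¹ * |lam| ^ (2 * n))

lemma measurable_fanDensity (n k : ℕ) : Measurable (fanDensity n k) := by
  unfold fanDensity; fun_prop

lemma fanMeasure_eq (n : ℕ) : fanMeasure n =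
    Measure.sum fun k : ℕ =>
      ((volume : Measure ℝ).withDensity (fanDensity n k)).map (fanPoint n k) :=
  rfl

lemma lintegral_fanMeasure (n : ℕ) {Q : fan n → ENNReal} (hQ : Measurable Q) :
    ∫⁻ a, Q a ∂(fanMeasure n) = ∑' k, ∫⁻ lam, fanDensity n k lam * Q (fanPoint n k lam) := by
  rw [fanMeasure_eq, lintegral_sum_measure]
  refine tsum_congr fun k => ?_
  rw [lintegral_map hQ (measurable_fanPoint n k)]
  exact lintegral_withDensity_eq_lintegral_mul _ (measurable_fanDensity n k)
    (hQ.comp (measurable_fanPoint n k))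

lemma specMeasure_eq (n : ℕ) : specMeasure n = Measure.sum fun k : ℕ =>
    (((volume : Measure ℝ).prod (volume : Measure (Fin n → ℂ))).withDensity
      fun p => fanDensity n k p.1).map (Prod.map (fanPoint n k) id) := by
  rw [specMeasure, fanMeasure_eq, Measure.prod_sum_left]
  congr 1
  funext k
  rw [← prod_withDensity_left (measurable_fanDensity n k),
    ← Measure.map_prod_map _ _ (measurable_fanPoint n k) measurable_id, Measure.map_id]

lemma measurableEmbedding_fanPoint_prod (n k : ℕ) :
    MeasurableEmbedding (Prod.map (fanPoint n k) (id : (Fin n → ℂ) → Fin n → ℂ)) :=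
  (measurableEmbedding_fanPoint n k).prodMap MeasurableEmbedding.id

lemma lintegral_specMeasure (n : ℕ) (Q : fan n × (Fin n → ℂ) → ENNReal)
    (hQ : ∀ k, AEMeasurable (fun p : ℝ × (Fin n → ℂ) => Q (fanPoint n k p.1, p.2))
      (volume.prod volume)) :
    ∫⁻ x, Q x ∂(specMeasure n) =
      ∑' k, ∫⁻ lam, fanDensity n k lam * ∫⁻ w, Q (fanPoint n k lam, w) := by
  rw [specMeasure_eq, lintegral_sum_measure]
  refine tsum_congr fun k => ?_
  have hd : Measurable fun p : ℝ × (Fin n → ℂ) => fanDensity n k p.1 :=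
    (measurable_fanDensity n k).comp measurable_fst
  rw [(measurableEmbedding_fanPoint_prod n k).lintegral_map]
  simp only [Prod.map, id]
  rw [lintegral_withDensity_eq_lintegral_mul₀ hd.aemeasurable (hQ k),
    lintegral_prod _ (hd.aemeasurable.mul (hQ k))]
  refine lintegral_congr fun lam => ?_
  exact lintegral_const_mul' (fanDensity n k lam) _ ENNReal.ofReal_ne_top

lemma aestronglyMeasurable_strichartz_fanPoint {n : ℕ} (hn : 1 ≤ n) (k : ℕ) {u : Heis n → ℂ}
    (hum : StronglyMeasurable u) (hu : Integrable u) :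
    AEStronglyMeasurable (fun p : ℝ × (Fin n → ℂ) => strichartz u (fanPoint n k p.1, p.2))
      (volume.prod volume) := by
  have h := (stronglyMeasurable_twistedConv k (stronglyMeasurable_centralFourier hum)).const_mul
    (cst n k : ℂ)
  refine ⟨_, h, ?_⟩
  have h0 : ∀ᵐ p : ℝ × (Fin n → ℂ) ∂(volume.prod volume), p.1 ≠ 0 :=
    Measure.quasiMeasurePreserving_fst.ae (Measure.ae_ne volume (0 : ℝ))
  filter_upwards [h0] with p hp
  exact strichartz_fanPoint_eq_twistedConv hn k hp hu p.2

lemma aestronglyMeasurable_strichartz {n : ℕ} (hn : 1 ≤ n) {u : Heis n → ℂ}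
    (hum : StronglyMeasurable u) (hu : Integrable u) :
    AEStronglyMeasurable (strichartz u) (specMeasure n) := by
  rw [specMeasure_eq]
  refine AEStronglyMeasurable.sum_measure fun k => ?_
  rw [(measurableEmbedding_fanPoint_prod n k).aestronglyMeasurable_map_iff]
  exact (aestronglyMeasurable_strichartz_fanPoint hn k hum hu).mono_ac
    (withDensity_absolutelyContinuous _ _)

lemma lintegral_enorm_sq_strichartz {n : ℕ} (hn : 1 ≤ n) {u : Heis n → ℂ}
    (hum : StronglyMeasurable u) (hu : Integrable u) (hu2 : MemLp u 2) :
    ∫⁻ x, ‖strichartz u x‖ₑ ^ 2 ∂(specMeasure n) = ∫⁻ p, ‖u p‖ₑ ^ 2 := by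
  have hpi := Real.pi_pos
  have hcF := stronglyMeasurable_centralFourier hum
  have htc := fun k => stronglyMeasurable_twistedConv k hcF
  have h0 : ∀ᵐ lam : ℝ, lam ≠ 0 := Measure.ae_ne volume (0 : ℝ)
  rw [lintegral_specMeasure n _ fun k =>
    (aestronglyMeasurable_strichartz_fanPoint hn k hum hu).enorm.pow_const 2]
  -- The normalization c_{n,k}² of the transform cancels c_{n,k}⁻² in ν₂, so this weight does not
  -- depend on k; times (2π/|λ|)²ⁿ it becomes 1/(2π).
  set D : ℝ → ENNReal := fun lam =>
    ENNReal.ofReal (((2 * Real.pi) ^ (2 * n + 1))⁻¹ * |lam| ^ (2 * n))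
    with hD
  have h1 : ∀ k, ∫⁻ lam, fanDensity n k lam * ∫⁻ w, ‖strichartz u (fanPoint n k lam, w)‖ₑ ^ 2 =
      ∫⁻ lam, D lam * ∫⁻ w, ‖twistedConv k lam (centralFourier u lam) w‖ₑ ^ 2 := by
    intro k
    refine lintegral_congr_ae ?_
    filter_upwards [h0] with lam hl
    have hc := cst_pos n k
    simp_rw [strichartz_fanPoint_eq_twistedConv hn k hl hu, enorm_mul, mul_pow]
    rw [lintegral_const_mul' _ _ (by simp), ← mul_assoc]
    congr 1
    have h2 : ‖(cst n k : ℂ)‖ₑ = ENNReal.ofReal (cst n k) := by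
      rw [← ofReal_norm, Complex.norm_real, Real.norm_of_nonneg hc.le]
    rw [h2, fanDensity, ← ENNReal.ofReal_pow hc.le, ← ENNReal.ofReal_mul (by positivity)]
    simp only [hD]
    congr 1
    field_simp
  have hmk : ∀ k, Measurable fun lam => ∫⁻ w, ‖twistedConv k lam (centralFourier u lam) w‖ₑ ^ 2 :=
    fun k => ((htc k).measurable.enorm.pow_const 2).lintegral_prod_right'
  have hDm : Measurable D := by simp only [hD]; fun_prop
  simp_rw [h1]
  have hDmk : ∀ k, AEMeasurable fun lam =>
      D lam * ∫⁻ w, ‖twistedConv k lam (centralFourier u lam) w‖ₑ ^ 2 :=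
    fun k => (hDm.mul (hmk k)).aemeasurable
  rw [← lintegral_tsum hDmk]
  have hfin : ∫⁻ lam : ℝ, ∫⁻ z, ‖centralFourier u lam z‖ₑ ^ 2 ≠ ⊤ := by
    rw [lintegral_enorm_sq_centralFourier hum hu hu2]
    refine ENNReal.mul_ne_top ENNReal.ofReal_ne_top ?_
    have := (lintegral_rpow_enorm_lt_top_of_eLpNorm_lt_top (by norm_num) (by norm_num) hu2.2).ne
    simpa using this
  have hm2 : Measurable fun lam : ℝ => ∫⁻ z, ‖centralFourier u lam z‖ₑ ^ 2 :=
    (hcF.measurable.enorm.pow_const 2).lintegral_prod_right'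
  have h3 : ∀ᵐ lam : ℝ, ∑' k, D lam * ∫⁻ w, ‖twistedConv k lam (centralFourier u lam) w‖ₑ ^ 2 =
      ENNReal.ofReal (2 * Real.pi)⁻¹ * ∫⁻ z, ‖centralFourier u lam z‖ₑ ^ 2 := by
    filter_upwards [h0, ae_lt_top hm2 hfin] with lam hl hlt
    have ha := abs_pos.2 hl
    have hgm : StronglyMeasurable (centralFourier u lam) :=
      hcF.comp_measurable (measurable_prodMk_left (x := lam))
    have hg2 : MemLp (centralFourier u lam) 2 := by
      refine ⟨hgm.aestronglyMeasurable, ?_⟩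
      rw [eLpNorm_lt_top_iff_lintegral_rpow_enorm_lt_top (by norm_num) (by norm_num)]
      simpa using hlt
    rw [ENNReal.tsum_mul_left, tsum_lintegral_twistedConv hn hl hgm
      (integrable_centralFourier hu lam) hg2, ← mul_assoc]
    congr 1
    simp only [hD]
    rw [← ENNReal.ofReal_mul (by positivity), div_pow]
    congr 1
    field_simp
    ring
  rw [lintegral_congr_ae h3, lintegral_const_mul _ hm2,
    lintegral_enorm_sq_centralFourier hum hu hu2,
    ← mul_assoc, ← ENNReal.ofReal_mul (by positivity), inv_mul_cancel₀ (by positivity)]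
  simp

lemma eLpNorm_strichartz {n : ℕ} (hn : 1 ≤ n) {u : Heis n → ℂ}
    (hum : StronglyMeasurable u) (hu : Integrable u) (hu2 : MemLp u 2) :
    eLpNorm (strichartz u) 2 (specMeasure n) = eLpNorm u 2 volume := by
  rw [eLpNorm_eq_lintegral_rpow_enorm_toReal (by norm_num) (by norm_num),
    eLpNorm_eq_lintegral_rpow_enorm_toReal (by norm_num) (by norm_num)]
  have := lintegral_enorm_sq_strichartz hn hum hu hu2
  simp [this]

/-! ### The Strichartz transform on `L²` -/

lemma enorm_Lp_sq_eq_lintegral {α : Type*} [MeasurableSpace α] {μ : Measure α} (F : Lp ℂ 2 μ) :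
    ‖F‖ₑ ^ 2 = ∫⁻ x, ‖F x‖ₑ ^ 2 ∂μ := by
  rw [Lp.enorm_def]
  simpa using eLpNorm_nnreal_pow_eq_lintegral (f := F) (μ := μ) (p := 2) (by norm_num)

/-- The graph of the Strichartz transform on `L¹ ∩ L²`. -/
def strichartzGraph (n : ℕ) :
    Set (Lp ℂ 2 (volume : Measure (Heis n)) × Lp ℂ 2 (specMeasure n)) :=
  {p | MemLp p.1 1 volume ∧ p.2 =ᵐ[specMeasure n] strichartz p.1}

lemma norm_eq_of_mem_strichartzGraph {n : ℕ} (hn : 1 ≤ n) {p} (hp : p ∈ strichartzGraph n) :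
    ‖p.2‖ = ‖p.1‖ := by
  rw [Lp.norm_def, Lp.norm_def, eLpNorm_congr_ae hp.2, eLpNorm_strichartz hn
    (Lp.stronglyMeasurable _) (memLp_one_iff_integrable.1 hp.1) (Lp.memLp _)]

/-- Equality of norms is a closed condition, so it passes from the graph on L¹ ∩ L² to its closure.
-/
lemma IsStrichartzTransform.norm_eq {n : ℕ} (hn : 1 ≤ n)
    {f : Lp ℂ 2 (volume : Measure (Heis n))} {g : Lp ℂ 2 (specMeasure n)}
    (h : IsStrichartzTransform f g) : ‖g‖ = ‖f‖ := by
  set C : Set (Lp ℂ 2 (volume : Measure (Heis n)) × Lp ℂ 2 (specMeasure n)) :=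
    {p | ‖p.2‖ = ‖p.1‖} with hC
  have hc : IsClosed C := by
    rw [hC]
    exact isClosed_eq (by fun_prop) (by fun_prop)
  have hsub : strichartzGraph n ⊆ C := fun p hp => norm_eq_of_mem_strichartzGraph hn hp
  have h' : (f, g) ∈ closure (strichartzGraph n) := h
  have h2 := closure_minimal hsub hc h'
  exact h2

lemma strichartz_sub {n : ℕ} (hn : 1 ≤ n) {u v : Heis n → ℂ} (hu : Integrable u)
    (hv : Integrable v) (k : ℕ) {lam : ℝ} (hl : lam ≠ 0) (w : Fin n → ℂ) :
    strichartz (u - v) (fanPoint n k lam, w) =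
      strichartz u (fanPoint n k lam, w) - strichartz v (fanPoint n k lam, w) := by
  simp only [strichartz_fanPoint k hl, Pi.sub_apply, sub_mul]
  rw [integral_sub (integrable_mul_eigenFun hn k lam hu w)
    (integrable_mul_eigenFun hn k lam hv w), mul_sub]

/-- λ = 0 is Lebesgue-null in every chart `fanPoint n k`, so the limiting ray may be ignored. -/
lemma ae_specMeasure {n : ℕ} {P : fan n × (Fin n → ℂ) → Prop}
    (h : ∀ k (lam : ℝ), lam ≠ 0 → ∀ w, P (fanPoint n k lam, w)) : ∀ᵐ x ∂(specMeasure n), P x := by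
  rw [specMeasure_eq, Measure.ae_sum_iff]
  intro k
  rw [(measurableEmbedding_fanPoint_prod n k).ae_map_iff]
  have h0 : ∀ᵐ p : ℝ × (Fin n → ℂ) ∂(volume.prod volume), p.1 ≠ 0 :=
    Measure.quasiMeasurePreserving_fst.ae (Measure.ae_ne volume (0 : ℝ))
  exact (withDensity_absolutelyContinuous _ _).ae_le (h0.mono fun p hp => h k p.1 hp p.2)

lemma strichartz_congr_ae {n : ℕ} {u v : Heis n → ℂ} (h : u =ᵐ[volume] v) :
    strichartz u = strichartz v := by
  funext x
  have h1 : ∀ e : Heis n → ℂ, ∫ p, u p * e p = ∫ p, v p * e p := fun e =>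
    integral_congr_ae (h.mono fun p hp => by simp only [hp])
  simp only [strichartz, h1]

lemma sub_mem_strichartzGraph {n : ℕ} (hn : 1 ≤ n) {p q} (hp : p ∈ strichartzGraph n)
    (hq : q ∈ strichartzGraph n) : p - q ∈ strichartzGraph n := by
  refine ⟨(memLp_congr_ae (Lp.coeFn_sub p.1 q.1)).2 (hp.1.sub hq.1), ?_⟩
  have h1 : ∀ᵐ x ∂(specMeasure n), strichartz (⇑p.1 - ⇑q.1) x =
      strichartz p.1 x - strichartz q.1 x :=
    ae_specMeasure fun k lam hl w => strichartz_sub hn (memLp_one_iff_integrable.1 hp.1)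
      (memLp_one_iff_integrable.1 hq.1) k hl w
  have h2 : strichartz (⇑(p - q).1) = strichartz (⇑p.1 - ⇑q.1) :=
    strichartz_congr_ae (Lp.coeFn_sub p.1 q.1)
  rw [h2]
  filter_upwards [h1, hp.2, hq.2, Lp.coeFn_sub p.2 q.2] with x h1 h3 h4 h5
  rw [h1, ← h3, ← h4]
  exact h5

/-- With `norm_eq` this gives ‖Ff - FU‖ = ‖f - U‖, the only linearity the concentration estimate
uses. -/
lemma IsStrichartzTransform.sub {n : ℕ} (hn : 1 ≤ n)
    {f f' : Lp ℂ 2 (volume : Measure (Heis n))} {g g' : Lp ℂ 2 (specMeasure n)}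
    (h : IsStrichartzTransform f g) (h' : IsStrichartzTransform f' g') :
    IsStrichartzTransform (f - f') (g - g') :=
  map_mem_closure₂ (f := fun p q => p - q) continuous_sub h h'
    fun _ hp _ hq => sub_mem_strichartzGraph hn hp hq

lemma exists_strichartzTransform {n : ℕ} (hn : 1 ≤ n) {U : Lp ℂ 2 (volume : Measure (Heis n))}
    (hU : Integrable U) : ∃ G : Lp ℂ 2 (specMeasure n), IsStrichartzTransform U G ∧
      G =ᵐ[specMeasure n] strichartz U := by
  have hm : MemLp (strichartz U) 2 (specMeasure n) := by
    refine ⟨aestronglyMeasurable_strichartz hn (Lp.stronglyMeasurable U) hU, ?_⟩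
    rw [eLpNorm_strichartz hn (Lp.stronglyMeasurable U) hU (Lp.memLp U)]
    exact Lp.eLpNorm_lt_top U
  exact ⟨hm.toLp _, subset_closure ⟨memLp_one_iff_integrable.2 hU, hm.coeFn_toLp⟩, hm.coeFn_toLp⟩

/-! ### Concentration estimate -/

lemma sq_lintegral_mul_le {α : Type*} [MeasurableSpace α] {μ : Measure α} {a b : α → ENNReal}
    (ha : AEMeasurable a μ) (hb : AEMeasurable b μ) :
    (∫⁻ x, a x * b x ∂μ) ^ 2 ≤ (∫⁻ x, a x ^ 2 ∂μ) * ∫⁻ x, b x ^ 2 ∂μ := by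
  have h := ENNReal.lintegral_mul_le_Lp_mul_Lq μ (p := 2) (q := 2)
    Real.HolderConjugate.two_two ha hb
  calc _ ≤ _ := pow_le_pow_left' h 2
    _ = _ := by
      rw [mul_pow, ← ENNReal.rpow_natCast, ← ENNReal.rpow_natCast, ← ENNReal.rpow_mul,
        ← ENNReal.rpow_mul]
      norm_num

lemma lintegral_enorm_sq_laguerreFun {n : ℕ} (hn : 1 ≤ n) (k : ℕ) {lam : ℝ} (hl : lam ≠ 0)
    (z : Fin n → ℂ) :
    ∫⁻ w, ‖laguerreFun n k lam (w - z)‖ₑ ^ 2 =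
      ENNReal.ofReal ((2 * Real.pi / |lam|) ^ n * (cst n k)⁻¹) := by
  rw [lintegral_sub_right_eq_self (fun w => ‖laguerreFun n k lam w‖ₑ ^ 2),
    ← integral_laguerreFun_sq hn k hl, ofReal_integral_eq_lintegral_ofReal
      (integrable_laguerreFun_sq hn k hl) (Filter.Eventually.of_forall fun w => by positivity)]
  refine lintegral_congr fun w => ?_
  rw [← sq_abs, ENNReal.ofReal_pow (abs_nonneg _), ← Real.norm_eq_abs, ofReal_norm]

/-- After Cauchy–Schwarz the Laguerre function is kept only on V. Tonelli then integrates w first,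
with a value independent of z, and c² · c⁻¹ = c ≤ 1. -/
lemma lintegral_strichartz_indicator_le {n : ℕ} (hn : 1 ≤ n) (k : ℕ) {lam : ℝ} (hl : lam ≠ 0)
    {V : Set (Heis n)} (hV : MeasurableSet V) {f : Heis n → ℂ} (hf : StronglyMeasurable f) :
    ∫⁻ w, ‖strichartz (V.indicator f) (fanPoint n k lam, w)‖ₑ ^ 2 ≤
      ENNReal.ofReal ((2 * Real.pi / |lam|) ^ n) * (volume V * ∫⁻ p, ‖f p‖ₑ ^ 2) := by
  have hc := cst_pos n k
  have hpi := Real.pi_pos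
  have hcn : ‖(cst n k : ℂ)‖ₑ = ENNReal.ofReal (cst n k) := by
    rw [← ofReal_norm, Complex.norm_real, Real.norm_of_nonneg hc.le]
  have hφ : Measurable fun q : (Fin n → ℂ) × Heis n =>
      ‖laguerreFun n k lam (q.1 - q.2.1)‖ₑ ^ 2 := by
    have h : Continuous fun q : (Fin n → ℂ) × Heis n => laguerreFun n k lam (q.1 - q.2.1) :=
      (continuous_laguerreFun n k lam).comp (by fun_prop)
    exact h.measurable.enorm.pow_const 2
  have h1 : ∀ w, ‖strichartz (V.indicator f) (fanPoint n k lam, w)‖ₑ ^ 2 ≤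
      ENNReal.ofReal (cst n k ^ 2) * ((∫⁻ p, ‖f p‖ₑ ^ 2) *
        ∫⁻ p in V, ‖laguerreFun n k lam (w - p.1)‖ₑ ^ 2) := by
    intro w
    rw [strichartz_fanPoint k hl, enorm_mul, mul_pow, hcn, ← ENNReal.ofReal_pow hc.le]
    gcongr
    have hφw : Measurable fun p : Heis n => ‖laguerreFun n k lam (w - p.1)‖ₑ := by
      have h : Continuous fun p : Heis n => laguerreFun n k lam (w - p.1) :=
        (continuous_laguerreFun n k lam).comp (by fun_prop)
      exact h.measurable.enorm
    calc _ ≤ (∫⁻ p, ‖V.indicator f p * eigenFun n k lam (mul (inv p) (w, 0))‖ₑ) ^ 2 :=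
          pow_le_pow_left' (enorm_integral_le_lintegral_enorm _) 2
      _ = (∫⁻ p in V, ‖f p‖ₑ * ‖laguerreFun n k lam (w - p.1)‖ₑ) ^ 2 := by
          rw [← lintegral_indicator hV]
          congr 2
          funext p
          by_cases hp : p ∈ V
          · rw [Set.indicator_of_mem hp, Set.indicator_of_mem hp, enorm_mul, ← ofReal_norm,
              ← ofReal_norm (eigenFun _ _ _ _), norm_eigenFun_inv_mul, ← Real.norm_eq_abs,
              ofReal_norm, ofReal_norm]
          · simp [hp]
      _ ≤ _ := sq_lintegral_mul_le hf.measurable.enorm.aemeasurable hφw.aemeasurable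
      _ ≤ _ := by
          gcongr
          exact Measure.restrict_le_self
  calc _ ≤ ∫⁻ w, ENNReal.ofReal (cst n k ^ 2) * ((∫⁻ p, ‖f p‖ₑ ^ 2) *
        ∫⁻ p in V, ‖laguerreFun n k lam (w - p.1)‖ₑ ^ 2) := lintegral_mono h1
    _ = ENNReal.ofReal (cst n k ^ 2) * ((∫⁻ p, ‖f p‖ₑ ^ 2) *
        (ENNReal.ofReal ((2 * Real.pi / |lam|) ^ n * (cst n k)⁻¹) * volume V)) := by
        have hm : Measurable fun w => ∫⁻ p in V, ‖laguerreFun n k lam (w - p.1)‖ₑ ^ 2 :=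
          hφ.lintegral_prod_right'
        rw [lintegral_const_mul _ (hm.const_mul _), lintegral_const_mul _ hm,
          lintegral_lintegral_swap hφ.aemeasurable]
        simp_rw [lintegral_enorm_sq_laguerreFun hn k hl]
        rw [setLIntegral_const]
    _ = ENNReal.ofReal (cst n k) * (ENNReal.ofReal ((2 * Real.pi / |lam|) ^ n) *
          (volume V * ∫⁻ p, ‖f p‖ₑ ^ 2)) := by
        have h2 : ENNReal.ofReal (cst n k ^ 2) *
            ENNReal.ofReal ((2 * Real.pi / |lam|) ^ n * (cst n k)⁻¹) =
            ENNReal.ofReal (cst n k) * ENNReal.ofReal ((2 * Real.pi / |lam|) ^ n) := by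
          rw [← ENNReal.ofReal_mul (by positivity), ← ENNReal.ofReal_mul (by positivity)]
          congr 1
          field_simp
        rw [← mul_assoc (ENNReal.ofReal (cst n k)), ← h2]
        ring
    _ ≤ _ := by
        refine mul_le_of_le_one_left' ?_
        exact ENNReal.ofReal_le_one.2 (cst_le_one n k)

lemma setLIntegral_strichartz_indicator_le {n : ℕ} (hn : 1 ≤ n) {V : Set (Heis n)}
    (hV : MeasurableSet V) {f : Heis n → ℂ} (hf : StronglyMeasurable f)
    (hVf : Integrable (V.indicator f)) {S : Set (fan n)} (hS : MeasurableSet S) {M : ℝ} (hM : 0 < M)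
    (hSM : ∀ a ∈ S, M < |a.1.1|) :
    ∫⁻ x in S ×ˢ Set.univ, ‖strichartz (V.indicator f) x‖ₑ ^ 2 ∂(specMeasure n) ≤
      ENNReal.ofReal ((2 * Real.pi / M) ^ n) * (volume V * ∫⁻ p, ‖f p‖ₑ ^ 2) * fanMeasure n S := by
  have hpi := Real.pi_pos
  set K := ENNReal.ofReal ((2 * Real.pi / M) ^ n) * (volume V * ∫⁻ p, ‖f p‖ₑ ^ 2)
  have hA : MeasurableSet (S ×ˢ (Set.univ : Set (Fin n → ℂ))) := hS.prod MeasurableSet.univ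
  have hSk : ∀ k, Measurable fun p : ℝ × (Fin n → ℂ) => S.indicator (1 : fan n → ENNReal)
      (fanPoint n k p.1) := fun k =>
    (measurable_one.indicator hS).comp ((measurable_fanPoint n k).comp measurable_fst)
  rw [← lintegral_indicator hA]
  have h1 : ∀ x : fan n × (Fin n → ℂ), (S ×ˢ (Set.univ : Set (Fin n → ℂ))).indicator
      (fun x => ‖strichartz (V.indicator f) x‖ₑ ^ 2) x =
      S.indicator (1 : fan n → ENNReal) x.1 * ‖strichartz (V.indicator f) x‖ₑ ^ 2 := by
    intro x
    by_cases hx : x.1 ∈ S <;> simp [hx, Set.indicator]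
  simp_rw [h1]
  have hum : StronglyMeasurable (V.indicator f) := hf.indicator hV
  rw [lintegral_specMeasure n (fun x => S.indicator (1 : fan n → ENNReal) x.1 *
    ‖strichartz (V.indicator f) x‖ₑ ^ 2) fun k => (hSk k).aemeasurable.mul
    ((aestronglyMeasurable_strichartz_fanPoint hn k hum hVf).enorm.pow_const 2),
    ← lintegral_indicator_one hS, lintegral_fanMeasure n (measurable_one.indicator hS),
    ← ENNReal.tsum_mul_left]
  refine ENNReal.tsum_le_tsum fun k => ?_
  have hmS : Measurable fun lam => fanDensity n k lam *
      S.indicator (1 : fan n → ENNReal) (fanPoint n k lam) :=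
    (measurable_fanDensity n k).mul ((measurable_one.indicator hS).comp (measurable_fanPoint n k))
  rw [← lintegral_const_mul _ hmS]
  refine lintegral_mono fun lam => ?_
  simp only
  by_cases hx : fanPoint n k lam ∈ S
  · have hl : M < |lam| := hSM _ hx
    have hl0 : lam ≠ 0 := abs_pos.1 (hM.trans hl)
    simp only [Set.indicator_of_mem hx, Pi.one_apply, one_mul, mul_one]
    rw [mul_comm K]
    gcongr
    refine (lintegral_strichartz_indicator_le hn k hl0 hV hf).trans ?_
    simp only [K]
    gcongr
  · simp [hx]

/-! ### The uncertainty principle -/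

lemma one_sub_sqrt_mul_norm_le {n : ℕ} (hn : 1 ≤ n) {V : Set (Heis n)}
    {S : Set (fan n)} (hS : MeasurableSet S) {εV εW : ℝ} (hεV : 0 < εV)
    {f U h : Lp ℂ 2 (volume : Measure (Heis n))} {g g' G : Lp ℂ 2 (specMeasure n)}
    (hfV : IsTimeLimited εV V f) (hU : U =ᵐ[volume] V.indicator f)
    (hfg : IsStrichartzTransform f g) (hhg : IsStrichartzTransform h g')
    (hUG : IsStrichartzTransform U G)
    (hg' : g' =ᵐ[specMeasure n] (Sᶜ ×ˢ (Set.univ : Set (Fin n → ℂ))).indicator g)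
    (hh : ‖h‖ ≤ εW * ‖f‖) :
    ENNReal.ofReal ((1 - Real.sqrt (εV ^ 2 + εW ^ 2)) * ‖f‖) ^ 2 ≤
      ∫⁻ x in S ×ˢ Set.univ, ‖G x‖ₑ ^ 2 ∂(specMeasure n) := by
  set A := S ×ˢ (Set.univ : Set (Fin n → ℂ)) with hA_def
  have hA : MeasurableSet A := hS.prod MeasurableSet.univ
  have hAc : Sᶜ ×ˢ (Set.univ : Set (Fin n → ℂ)) = Aᶜ := by
    ext x; simp [A]
  rw [hAc] at hg'
  have hq : MemLp (A.indicator G) 2 (specMeasure n) := (Lp.memLp G).indicator hA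
  set q := hq.toLp _
  have hqn : ‖q‖ₑ ^ 2 = ∫⁻ x in A, ‖G x‖ₑ ^ 2 ∂(specMeasure n) := by
    rw [enorm_Lp_sq_eq_lintegral, ← lintegral_indicator hA]
    refine lintegral_congr_ae ?_
    filter_upwards [hq.coeFn_toLp] with x hx
    rw [hx]
    by_cases hxA : x ∈ A <;> simp [hxA]
  -- Orthogonality of the pieces on and off A is what yields √(ε_V² + ε_W²) instead of ε_V + ε_W.
  have hsplit : ‖g - q‖ₑ ^ 2 ≤ ‖g'‖ₑ ^ 2 + ‖g - G‖ₑ ^ 2 := by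
    rw [enorm_Lp_sq_eq_lintegral (g - q), ← lintegral_add_compl _ hA, add_comm]
    refine add_le_add ?_ ?_
    · rw [enorm_Lp_sq_eq_lintegral g', ← lintegral_indicator hA.compl]
      refine lintegral_mono_ae ?_
      filter_upwards [hq.coeFn_toLp, Lp.coeFn_sub g q, hg'] with x h1 h2 h3
      by_cases hxA : x ∈ A
      · simp [hxA]
      · rw [h3, Set.indicator_of_mem (show x ∈ Aᶜ from hxA),
          Set.indicator_of_mem (show x ∈ Aᶜ from hxA), h2, Pi.sub_apply, h1,
          Set.indicator_of_notMem hxA, sub_zero]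
    · rw [enorm_Lp_sq_eq_lintegral (g - G), ← lintegral_indicator hA]
      refine lintegral_mono_ae ?_
      filter_upwards [hq.coeFn_toLp, Lp.coeFn_sub g q, Lp.coeFn_sub g G] with x h1 h2 h3
      by_cases hxA : x ∈ A
      · rw [Set.indicator_of_mem hxA, h2, h3, Pi.sub_apply, h1, Set.indicator_of_mem hxA,
          Pi.sub_apply]
      · simp [hxA]
  have hfU : ‖f - U‖ ≤ εV * ‖f‖ := by
    have h1 : (f - U : Lp ℂ 2 (volume : Measure (Heis n))) =ᵐ[volume] Vᶜ.indicator f := by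
      filter_upwards [Lp.coeFn_sub f U, hU] with p h2 h3
      rw [h2, Pi.sub_apply, h3]
      by_cases hp : p ∈ V <;> simp [hp]
    have h2 := hfV
    rw [IsTimeLimited, ← eLpNorm_congr_ae h1, ← Lp.enorm_def, ← Lp.enorm_def, ← ofReal_norm,
      ← ofReal_norm, ← ENNReal.ofReal_mul hεV.le,
      ENNReal.ofReal_le_ofReal_iff (by positivity)] at h2
    exact h2
  have hreal : ‖g - q‖ ^ 2 ≤ ‖g'‖ ^ 2 + ‖g - G‖ ^ 2 := by
    simp only [← ofReal_norm, ← ENNReal.ofReal_pow (norm_nonneg _)] at hsplit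
    rwa [← ENNReal.ofReal_add (by positivity) (by positivity),
      ENNReal.ofReal_le_ofReal_iff (by positivity)] at hsplit
  rw [hhg.norm_eq hn, (hfg.sub hn hUG).norm_eq hn] at hreal
  have hgq : ‖g - q‖ ≤ Real.sqrt (εV ^ 2 + εW ^ 2) * ‖f‖ := by
    refine (sq_le_sq₀ (norm_nonneg _) (by positivity)).1 ?_
    rw [mul_pow, Real.sq_sqrt (by positivity)]
    have h1 := pow_le_pow_left₀ (norm_nonneg _) hh 2
    have h2 := pow_le_pow_left₀ (norm_nonneg _) hfU 2
    rw [mul_pow] at h1 h2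
    linarith
  have hfin : (1 - Real.sqrt (εV ^ 2 + εW ^ 2)) * ‖f‖ ≤ ‖q‖ := by
    have h1 : ‖g‖ ≤ ‖g - q‖ + ‖q‖ := by simpa using norm_add_le (g - q) q
    rw [hfg.norm_eq hn] at h1
    linarith
  rw [← hqn, ← ofReal_norm]
  exact pow_le_pow_left' (ENNReal.ofReal_le_ofReal hfin) 2

lemma specMeasure_prod_univ_ae_eq {n : ℕ} {S W : Set (fan n)} (h : S =ᵐ[fanMeasure n] W) :
    ∀ᵐ x ∂(specMeasure n), x.1 ∈ S ↔ x.1 ∈ W := by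
  have h2 := Measure.quasiMeasurePreserving_fst (μ := fanMeasure n)
    (ν := (volume : Measure (Fin n → ℂ)))
  exact h2.ae (h.mono fun a ha => iff_of_eq ha)

/-- If W were null, P_{Wᶜ}f would have the norm of f, contradicting ε_W < 1. This is needed when |V|
= ∞, because of the convention 0 · ∞ = 0. -/
lemma band_measure_ne_zero {n : ℕ} (hn : 1 ≤ n) {W : Set (fan n)} {εW : ℝ} (hεW : εW < 1)
    {f : Lp ℂ 2 (volume : Measure (Heis n))} (hf : f ≠ 0) (hfW : IsBandLimited εW W f) :
    fanMeasure n W ≠ 0 := by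
  intro h0
  obtain ⟨h, ⟨g, g', hfg, hhg, hg'⟩, hh⟩ := hfW
  have h1 : W =ᵐ[fanMeasure n] (∅ : Set (fan n)) := ae_eq_empty.2 h0
  have h2 : g' = g := by
    refine Lp.ext ?_
    filter_upwards [hg', specMeasure_prod_univ_ae_eq h1] with x h3 h4
    have h5 : x.1 ∉ W := by simpa using h4
    rw [h3, Set.indicator_of_mem]
    exact ⟨h5, trivial⟩
  rw [← hhg.norm_eq hn, h2, hfg.norm_eq hn] at hh
  have := norm_pos_iff.2 hf
  nlinarith

end StrichartzHeisenberg

open StrichartzHeisenberg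

theorem mainTheorem3 (n : ℕ) (hn : 1 ≤ n)
    (V : Set (StrichartzHeisenberg.Heis n)) (hV : MeasureTheory.NullMeasurableSet V)
    (W : Set (StrichartzHeisenberg.fan n))
    (hW : MeasureTheory.NullMeasurableSet W (StrichartzHeisenberg.fanMeasure n))
    (M : ℝ) (hM : 0 < M)
    (hWM : ∀ a ∈ W, ∃ (k : ℕ) (lam : ℝ), M < |lam| ∧ a.1 = (lam, (2 * k + n) * |lam|))
    (εV εW : ℝ) (hεV : 0 < εV) (hεW : 0 < εW) (hε : εV ^ 2 + εW ^ 2 < 1)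
    (f : MeasureTheory.Lp ℂ 2
      (MeasureTheory.volume : MeasureTheory.Measure (StrichartzHeisenberg.Heis n)))
    (hf : f ≠ 0)
    (hfV : StrichartzHeisenberg.IsTimeLimited εV V f)
    (hfW : StrichartzHeisenberg.IsBandLimited εW W f) :
    ENNReal.ofReal
        (((2 * Real.pi) ^ n)⁻¹ * M ^ n * (1 - Real.sqrt (εV ^ 2 + εW ^ 2)) ^ 2) ≤
      MeasureTheory.volume V * StrichartzHeisenberg.fanMeasure n W := by
  have hpi := Real.pi_pos
  have hW0 : fanMeasure n W ≠ 0 := band_measure_ne_zero hn (by nlinarith) hf hfW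
  by_cases hVtop : volume V = ⊤
  · rw [hVtop, ENNReal.top_mul hW0]
    exact le_top
  obtain ⟨V', -, hV'm, hV'⟩ := hV.exists_measurable_superset_ae_eq
  -- W is shrunk, not enlarged, so that |λ| > M still holds everywhere on `S`.
  obtain ⟨S, hSW, hSm, hS⟩ := hW.exists_measurable_subset_ae_eq
  obtain ⟨h, ⟨g, g', hfg, hhg, hg'⟩, hh⟩ := hfW
  have hfV' : IsTimeLimited εV V' f := by
    have h1 : V'ᶜ.indicator f =ᵐ[volume] Vᶜ.indicator f := indicator_ae_eq_of_ae_eq_set hV'.compl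
    rwa [IsTimeLimited, eLpNorm_congr_ae h1]
  have hV'top : volume V' ≠ ⊤ := by rwa [measure_congr hV']
  have hu2 : MemLp (V'.indicator f) 2 volume := (Lp.memLp f).indicator hV'm
  -- On a set of finite measure L² ⊆ L¹, so the transform of χ_V f is given by the integral formula.
  have hu1 : Integrable (V'.indicator f) volume := by
    have : IsFiniteMeasure ((volume : Measure (Heis n)).restrict V') :=
      ⟨by rw [Measure.restrict_apply_univ]; exact hV'top.lt_top⟩
    rw [integrable_indicator_iff hV'm]
    exact ((Lp.memLp f).restrict V').integrable (by norm_num)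
  have hU := hu2.coeFn_toLp
  obtain ⟨G, hUG, hG⟩ := exists_strichartzTransform hn (U := hu2.toLp _) (hu1.congr hU.symm)
  rw [strichartz_congr_ae hU] at hG
  have hg'S : g' =ᵐ[specMeasure n] (Sᶜ ×ˢ (Set.univ : Set (Fin n → ℂ))).indicator g := by
    filter_upwards [hg', specMeasure_prod_univ_ae_eq hS] with x h1 h2
    rw [h1]
    by_cases hx : x.1 ∈ W <;> simp [Set.indicator, hx, h2]
  have key := one_sub_sqrt_mul_norm_le hn hSm hεV hfV' hU hfg hhg hUG hg'S hh
  have hSM : ∀ a ∈ S, M < |a.1.1| := by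
    intro a ha
    obtain ⟨k, lam, hl, h2⟩ := hWM a (hSW ha)
    rw [h2]
    exact hl
  have hGi : ∫⁻ x in S ×ˢ Set.univ, ‖G x‖ₑ ^ 2 ∂(specMeasure n) =
      ∫⁻ x in S ×ˢ Set.univ, ‖strichartz (V'.indicator f) x‖ₑ ^ 2 ∂(specMeasure n) :=
    lintegral_congr_ae (ae_restrict_of_ae (hG.mono fun x hx => by simp only [hx]))
  rw [hGi] at key
  have key2 := key.trans (setLIntegral_strichartz_indicator_le hn hV'm (Lp.stronglyMeasurable f) hu1
    hSm hM hSM)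
  have hε1 : 0 < 1 - Real.sqrt (εV ^ 2 + εW ^ 2) := by
    have : Real.sqrt (εV ^ 2 + εW ^ 2) < 1 := (Real.sqrt_lt' one_pos).2 (by simpa using hε)
    linarith
  rw [← enorm_Lp_sq_eq_lintegral, measure_congr hV', measure_congr hS,
    ENNReal.ofReal_mul hε1.le, mul_pow, ofReal_norm] at key2
  have hf0 : ‖f‖ₑ ^ 2 ≠ 0 := pow_ne_zero 2 (enorm_ne_zero.2 hf)
  have hft : ‖f‖ₑ ^ 2 ≠ ⊤ := ENNReal.pow_ne_top enorm_ne_top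
  have key3 : ENNReal.ofReal (1 - Real.sqrt (εV ^ 2 + εW ^ 2)) ^ 2 ≤
      ENNReal.ofReal ((2 * Real.pi / M) ^ n) * (volume V * fanMeasure n W) := by
    refine (ENNReal.mul_le_mul_iff_left hf0 hft).1 (key2.trans (le_of_eq ?_))
    ring
  calc _ = ENNReal.ofReal (((2 * Real.pi) ^ n)⁻¹ * M ^ n) *
        ENNReal.ofReal (1 - Real.sqrt (εV ^ 2 + εW ^ 2)) ^ 2 := by
        rw [ENNReal.ofReal_mul (by positivity), ENNReal.ofReal_pow hε1.le]
    _ ≤ ENNReal.ofReal (((2 * Real.pi) ^ n)⁻¹ * M ^ n) *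
        (ENNReal.ofReal ((2 * Real.pi / M) ^ n) * (volume V * fanMeasure n W)) := by gcongr
    _ = _ := by
        rw [← mul_assoc, ← ENNReal.ofReal_mul (by positivity), div_pow]
        have : ((2 * Real.pi) ^ n)⁻¹ * M ^ n * ((2 * Real.pi) ^ n / M ^ n) = 1 := by field_simp
        rw [this, ENNReal.ofReal_one, one_mul]

end
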